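/- Let $n\ge 0$ be even, let $q_1,q_2,q_3,p_1,\dots,p_n\in\mathbb{CP}^1$ be distinct points, and fix a weight $\mu$ with $0<\mu<\frac{1}{2(n+3)}$. A rank 2 parabolic bundle $(E,\ell_{x_1},\dots,\ell_{x_k})$ is a rank 2 holomorphic vector bundle $E\to\mathbb{CP}^1$ with a line $\ell_{x_i}\subset E_{x_i}$ at each marked point; it is (semi)stable if $\deg L+\mu\sum_i\sigma_i<\frac12\deg E$ (respectively $\le$) for every holomorphic line subbundle $L\subset E$, where $\sigma_i=+1$ if $L_{x_i}=\ell_{x_i}$ and $\sigma_i=-1$ otherwise. Let $M^{ss}(S^2,n+3)$ be the set of $S$-equivalence classes of semistable rank 2 parabolic bundles $(E,\ell_{p_1},\dots,\ell_{p_n},\ell_{q_1},\ell_{q_2},\ell_{q_3})$ with $\det E$ trivial. (Two semistable parabolic bundles are $S$-equivalent if their associated graded parabolic bundles are isomorphic.) A Hecke modification of $E$ at $p$ is a holomorphic map $\alpha:F\to E$ of rank 2 bundles that is an isomorphism on fibers away from $p$ and that has near $p$ the matrix $\mathrm{diag}(1,\xi-\xi(p))$ for some local coordinate $\xi$ and some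 local holomorphic frames of $E$ and $F$. Let $\mathcal H_p(S^2,n)$ be the set of isomorphism classes of sequences $$(E,\ell_{q_1},\ell_{q_2},\ell_{q_3})\xleftarrow{\ \alpha_1\ }E_1\xleftarrow{\ \alpha_2\ }\cdots\xleftarrow{\ \alpha_n\ }E_n ,$$ with $E_0:=E$ and $\alpha_i:E_i\to E_{i-1}$ a Hecke modification of $E_{i-1}$ at $p_i$, such that $(E,\ell_{q_1},\ell_{q_2},\ell_{q_3})$ is stable, $\det E$ is trivial, and $E_n\cong\mathcal O(m)\oplus\mathcal O(m)$ for some integer $m$ (that is, $E_n$ is semistable of even degree). Isomorphisms of sequences are families of isomorphisms $E_i\to E_i'$, $0\le i\le n$, commuting with the maps $\alpha_i$ and carrying the lines $\ell_{q_j}$ to the lines $\ell_{q_j}'$. To such a sequence associate the lines $\ell_{p_i}:=\operatorname{im}\big((\alpha_1\circ\cdots\circ\alpha_i)_{p_i}:(E_i)_{p_i}\to E_{p_i}\big)$. Then $$\big[(E,\ell_{q_1},\ell_{q_2},\ell_{q_3})\leftarrow E_1\leftarrow\cdots\leftarrow E_n\big]\longmapsto\big[(E,\ell_{p_1},\dots,\ell_{p_n},\ell_{q_1},\ell_{q_2},\ell_{q_3})\big]$$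 is a well-defined map $\mathcal H_p(S^2,n)\to M^{ss}(S^2,n+3)$ (in particular the parabolic bundle on the right is semistable), and this map is injective. Moreover, for every such sequence and every global holomorphic trivialization $E\cong\mathbb{CP}^1\times\mathbb C^2$, at most $n/2$ of the lines $\ell_{p_1},\dots,\ell_{p_n}$ correspond to any one line in $\mathbb C^2$. -/

import Mathlib

open scoped Manifold ContDiff Topology Bundle
open Bundle Module

namespace HeckeEmbedding

noncomputable section

/-! ### The Riemann sphere as a complex manifold -/

/-- The complex projective line, as the one-point compactification of `ℂ`: the point `[1 : z]` is
`z`, and the point `[0 : 1]` is `∞`. -/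
abbrev CP1 : Type := OnePoint ℂ

/-- The inversion `z ↦ z⁻¹` of the sphere, exchanging `0` and `∞`. -/
def inversion (x : CP1) : CP1 :=
  x.elim ((0 : ℂ) : CP1) fun z => if z = 0 then OnePoint.infty else ((z⁻¹ : ℂ) : CP1)

@[simp] theorem inversion_infty : inversion OnePoint.infty = ((0 : ℂ) : CP1) := rfl

@[simp] theorem inversion_zero : inversion ((0 : ℂ) : CP1) = OnePoint.infty := by
  simp [inversion]

theorem inversion_coe {z : ℂ} (hz : z ≠ 0) : inversion (z : CP1) = ((z⁻¹ : ℂ) : CP1) := by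
  simp [inversion, hz]

theorem inversion_inversion (x : CP1) : inversion (inversion x) = x := by
  induction x using OnePoint.rec with
  | infty => simp
  | coe z =>
    by_cases hz : z = 0
    · subst hz; simp
    · rw [inversion_coe hz, inversion_coe (inv_ne_zero hz), inv_inv]

theorem continuous_inversion : Continuous inversion := by
  rw [OnePoint.continuous_iff]
  constructor
  · rw [inversion_infty]
    have h1 : Filter.Tendsto (fun z : ℂ => ((z⁻¹ : ℂ) : CP1)) (Filter.coclosedCompact ℂ)
        (𝓝 ((0 : ℂ) : CP1)) := by
      rw [Filter.coclosedCompact_eq_cocompact, ← Metric.cobounded_eq_cocompact]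
      exact (OnePoint.continuous_coe.tendsto 0).comp Filter.tendsto_inv₀_cobounded
    refine h1.congr' ?_
    rw [Filter.coclosedCompact_eq_cocompact, ← Metric.cobounded_eq_cocompact]
    filter_upwards [Bornology.eventually_ne_cobounded (0 : ℂ)] with z hz
    exact (inversion_coe hz).symm
  · rw [continuous_iff_continuousAt]
    intro z
    by_cases hz : z = 0
    · subst hz
      rw [continuousAt_iff_punctured_nhds]
      simp only [inversion_zero]
      have h1 : Filter.Tendsto (fun z : ℂ => ((z⁻¹ : ℂ) : CP1)) (𝓝[≠] (0 : ℂ))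
          (𝓝 (OnePoint.infty : CP1)) := by
        refine OnePoint.tendsto_coe_infty.comp ?_
        rw [Filter.coclosedCompact_eq_cocompact, ← Metric.cobounded_eq_cocompact]
        exact Filter.tendsto_inv₀_nhdsNE_zero
      refine h1.congr' ?_
      filter_upwards [self_mem_nhdsWithin] with z hz
      exact (inversion_coe hz).symm
    · have h1 : ContinuousAt (fun z : ℂ => ((z⁻¹ : ℂ) : CP1)) z :=
        OnePoint.continuous_coe.continuousAt.comp (continuousAt_inv₀ hz)
      refine h1.congr ?_
      filter_upwards [isOpen_ne.mem_nhds hz] with y hy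
      exact (inversion_coe hy).symm

/-- The inversion as a homeomorphism. -/
def inversionHomeomorph : CP1 ≃ₜ CP1 where
  toFun := inversion
  invFun := inversion
  left_inv := inversion_inversion
  right_inv := inversion_inversion
  continuous_toFun := continuous_inversion
  continuous_invFun := continuous_inversion

/-- The affine coordinate `z`, with the (irrelevant) value `0` at `∞`. -/
def zCoord (x : CP1) : ℂ := x.elim 0 id

/-- The affine coordinate `w = 1 / z`, with value `0` at `∞`
(and the irrelevant value `0` at the point `0`). -/
def wCoord (x : CP1) : ℂ := x.elim 0 fun z => z⁻¹

/-- The affine chart `z` on the complement of `∞`. -/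
def chartZ : OpenPartialHomeomorph CP1 ℂ where
  toFun := zCoord
  invFun := fun z => (z : CP1)
  source := {OnePoint.infty}ᶜ
  target := Set.univ
  map_source' := fun _ _ => Set.mem_univ _
  map_target' := fun z _ => by simp
  left_inv' := by
    intro x hx
    induction x using OnePoint.rec with
    | infty => simp at hx
    | coe z => rfl
  right_inv' := fun z _ => rfl
  open_source := by
    rw [OnePoint.compl_infty]
    exact OnePoint.isOpen_range_coe
  open_target := isOpen_univ
  continuousOn_toFun := by
    intro x hx
    induction x using OnePoint.rec with
    | infty => simp at hx
    | coe z =>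
      refine ContinuousAt.continuousWithinAt ?_
      rw [OnePoint.continuousAt_coe]
      exact continuousAt_id
  continuousOn_invFun := OnePoint.continuous_coe.continuousOn

/-- The affine chart `w` on the complement of `0`. -/
def chartW : OpenPartialHomeomorph CP1 ℂ :=
  inversionHomeomorph.toOpenPartialHomeomorph.trans chartZ

open Classical in
instance : ChartedSpace ℂ CP1 where
  atlas := {chartZ, chartW}
  chartAt := fun x => if x = OnePoint.infty then chartW else chartZ
  mem_chart_source := by
    intro x
    by_cases hx : x = OnePoint.infty
    · subst hx
      simp [chartW, chartZ, inversionHomeomorph]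
    · simp [hx, chartZ]
  chart_mem_atlas := by
    intro x
    by_cases hx : x = OnePoint.infty <;> simp [hx]

theorem atlas_eq : atlas ℂ CP1 = {chartZ, chartW} := rfl

@[simp] theorem zCoord_coe (z : ℂ) : zCoord (z : CP1) = z := rfl

@[simp] theorem wCoord_coe (z : ℂ) : wCoord (z : CP1) = z⁻¹ := rfl

theorem chartW_apply (x : CP1) : chartW x = wCoord x := by
  change zCoord (inversion x) = wCoord x
  induction x using OnePoint.rec with
  | infty => simp [wCoord]
  | coe z =>
    by_cases hz : z = 0
    · subst hz; simp [zCoord]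
    · rw [inversion_coe hz]; simp

theorem mem_chartZ_source {x : CP1} : x ∈ chartZ.source ↔ x ≠ OnePoint.infty := Iff.rfl

theorem mem_chartW_source {x : CP1} : x ∈ chartW.source ↔ x ≠ ((0 : ℂ) : CP1) := by
  have h1 : x ∈ chartW.source ↔ inversion x ≠ OnePoint.infty := by
    simp [chartW, chartZ, inversionHomeomorph]
  rw [h1, not_iff_not]
  constructor
  · intro h
    rw [← inversion_inversion x, h, inversion_infty]
  · rintro rfl
    exact inversion_zero

theorem wCoord_eq_inv_zCoord (x : CP1) : wCoord x = (zCoord x)⁻¹ := by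
  induction x using OnePoint.rec with
  | infty => simp [wCoord, zCoord]
  | coe z => simp

theorem zCoord_ne_zero {x : CP1} (h0 : x ≠ ((0 : ℂ) : CP1)) (h1 : x ≠ OnePoint.infty) :
    zCoord x ≠ 0 := by
  induction x using OnePoint.rec with
  | infty => exact absurd rfl h1
  | coe z =>
    intro h
    apply h0
    rw [zCoord_coe] at h
    rw [h]

instance : IsManifold 𝓘(ℂ) ω CP1 := by
  have key : ContDiffOn ℂ ω (fun z : ℂ => z⁻¹) {z | z ≠ 0} := fun z hz =>
    (contDiffAt_inv ℂ hz).contDiffWithinAt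
  apply isManifold_of_contDiffOn
  intro e e' he he'
  rw [atlas_eq] at he he'
  simp only [Set.mem_insert_iff, Set.mem_singleton_iff] at he he'
  simp only [modelWithCornersSelf_coe, modelWithCornersSelf_coe_symm, Function.comp_id,
    Function.id_comp, Set.preimage_id, Set.range_id, Set.inter_univ]
  rcases he with rfl | rfl <;> rcases he' with rfl | rfl
  · refine contDiffOn_id.congr fun z hz => ?_
    rfl
  · refine (key.mono ?_).congr fun z hz => ?_
    · intro z hz
      have h2 : ((z : ℂ) : CP1) ∈ chartW.source := hz.2
      rw [mem_chartW_source] at h2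
      intro h
      exact h2 (by rw [h])
    · change chartW (z : CP1) = _
      rw [chartW_apply, wCoord_coe]
  · have hne : ∀ z : ℂ, z ∈ (chartW.symm.trans chartZ).source → z ≠ 0 := by
      rintro z hz rfl
      have h2 : inversion ((0 : ℂ) : CP1) ∈ chartZ.source := hz.2
      rw [mem_chartZ_source, inversion_zero] at h2
      exact h2 rfl
    refine (key.mono hne).congr fun z hz => ?_
    change zCoord (inversion (z : CP1)) = _
    rw [inversion_coe (hne z hz), zCoord_coe]
  · refine contDiffOn_id.congr fun z hz => ?_
    exact chartW.right_inv hz.1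

/-! ### Holomorphic vector bundles and their morphisms -/

/-- A holomorphic vector bundle of rank `r` over `CP1`. (Over `ℂ`, the order of smoothness `ω` means
complex analytic, that is, holomorphic.) -/
structure HolBundle (r : ℕ) where
  /-- the model fiber -/
  Model : Type
  /-- the fibers -/
  Fiber : CP1 → Type
  [modelGroup : NormedAddCommGroup Model]
  [modelSpace : NormedSpace ℂ Model]
  [modelFinite : FiniteDimensional ℂ Model]
  [fiberGroup : ∀ x, AddCommGroup (Fiber x)]
  [fiberModule : ∀ x, Module ℂ (Fiber x)]
  [fiberTopology : ∀ x, TopologicalSpace (Fiber x)]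
  [totalTopology : TopologicalSpace (TotalSpace Model Fiber)]
  [fiberBundle : FiberBundle Model Fiber]
  [vectorBundle : VectorBundle ℂ Model Fiber]
  [holomorphic : ContMDiffVectorBundle ω Model Fiber 𝓘(ℂ)]
  finrank_model : finrank ℂ Model = r

attribute [instance] HolBundle.modelGroup HolBundle.modelSpace HolBundle.modelFinite
  HolBundle.fiberGroup HolBundle.fiberModule HolBundle.fiberTopology HolBundle.totalTopology
  HolBundle.fiberBundle HolBundle.vectorBundle HolBundle.holomorphic

theorem HolBundle.finrank_fiber {r : ℕ} (E : HolBundle r) (x : CP1) :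
    finrank ℂ (E.Fiber x) = r :=
  ((trivializationAt E.Model E.Fiber x).linearEquivAt ℂ x
    (FiberBundle.mem_baseSet_trivializationAt' x)).finrank_eq.trans E.finrank_model

/-- A holomorphic bundle map over the identity of `CP1`. -/
structure HolHom {r s : ℕ} (E : HolBundle r) (E' : HolBundle s) where
  /-- the linear maps on fibers -/
  onFiber : ∀ x, E.Fiber x →ₗ[ℂ] E'.Fiber x
  holomorphic : ContMDiff (𝓘(ℂ).prod 𝓘(ℂ, E.Model)) (𝓘(ℂ).prod 𝓘(ℂ, E'.Model)) ω
    (fun v : TotalSpace E.Model E.Fiber =>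
      (⟨v.proj, onFiber v.proj v.snd⟩ : TotalSpace E'.Model E'.Fiber))

/-- An isomorphism of holomorphic vector bundles. -/
structure HolIso {r s : ℕ} (E : HolBundle r) (E' : HolBundle s) where
  /-- the isomorphism -/
  hom : HolHom E E'
  /-- its inverse -/
  inv : HolHom E' E
  inv_hom : ∀ x v, inv.onFiber x (hom.onFiber x v) = v
  hom_inv : ∀ x v, hom.onFiber x (inv.onFiber x v) = v

/-- A holomorphic frame of `E` over `U`: holomorphic sections over `U` that form a basis of each
fiber; equivalently, a holomorphic trivialization of `E` over `U`. -/
def HolBundle.IsFrame {r : ℕ} (E : HolBundle r) (e : Fin r → ∀ x, E.Fiber x) (U : Set CP1) : Prop :=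
  IsLocalFrameOn 𝓘(ℂ) E.Model ω e U

/-! ### The bundles `O(n)`, trivial bundles, and direct sums -/

theorem contMDiffOn_zCoord_zpow (n : ℤ) : ContMDiffOn 𝓘(ℂ) 𝓘(ℂ, ℂ →L[ℂ] ℂ) ω
    (fun x : CP1 => (zCoord x) ^ n • ContinuousLinearMap.id ℂ ℂ)
    (chartZ.source ∩ chartW.source) := by
  have h1 : ContMDiffOn 𝓘(ℂ) 𝓘(ℂ) ω zCoord (chartZ.source ∩ chartW.source) :=
    (contMDiffOn_of_mem_maximalAtlas (I := 𝓘(ℂ)) (n := ω) (e := chartZ)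
      (IsManifold.subset_maximalAtlas (by rw [atlas_eq]; simp))).mono Set.inter_subset_left
  have h2 : ContMDiffOn 𝓘(ℂ) 𝓘(ℂ, ℂ →L[ℂ] ℂ) ω
      (fun z : ℂ => z ^ n • ContinuousLinearMap.id ℂ ℂ) {z | z ≠ 0} := by
    have h3 : ContDiffOn ℂ ω (fun z : ℂ => z ^ n) {z | z ≠ 0} := fun z hz =>
      (AnalyticAt.zpow (f := fun z : ℂ => z) analyticAt_id hz).contDiffAt.contDiffWithinAt
    have h4 : ContDiffOn ℂ ω (fun _ : ℂ => ContinuousLinearMap.id ℂ ℂ) {z | z ≠ 0} :=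
      contDiffOn_const
    exact (h3.smul h4).contMDiffOn
  refine h2.comp h1 ?_
  rintro x ⟨hx1, hx2⟩
  exact zCoord_ne_zero (mem_chartW_source.1 hx2) (mem_chartZ_source.1 hx1)

open Classical in
/-- The gluing data of `O(n)`: the trivial line bundles over `U₀ = {z ≠ ∞}` (index `false`) and
`U₁ = {z ≠ 0}` (index `true`) are glued by `(p, v)₀ ∼ (p, w(p) ^ n v)₁ = (p, z(p) ^ (-n) v)₁`. -/
def lineBundleCore (n : ℤ) : VectorBundleCore ℂ CP1 ℂ Bool where
  baseSet := fun i => if i then chartW.source else chartZ.source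
  isOpen_baseSet := by
    rintro (_ | _)
    · exact chartZ.open_source
    · exact chartW.open_source
  indexAt := fun x => if x = OnePoint.infty then true else false
  mem_baseSet_at := by
    intro x
    by_cases hx : x = OnePoint.infty
    · subst hx
      simp [mem_chartW_source]
    · simp [hx, mem_chartZ_source]
  coordChange := fun i j x => match i, j with
    | false, true => (zCoord x) ^ (-n) • ContinuousLinearMap.id ℂ ℂ
    | true, false => (zCoord x) ^ n • ContinuousLinearMap.id ℂ ℂ
    | _, _ => ContinuousLinearMap.id ℂ ℂ
  coordChange_self := by
    rintro (_ | _) x _ v <;> rfl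
  continuousOn_coordChange := by
    rintro (_ | _) (_ | _)
    · exact continuousOn_const
    · exact (contMDiffOn_zCoord_zpow (-n)).continuousOn
    · have h := (contMDiffOn_zCoord_zpow n).continuousOn
      rw [Set.inter_comm] at h
      exact h
    · exact continuousOn_const
  coordChange_comp := by
    rintro (_ | _) (_ | _) (_ | _) x ⟨⟨h1, h2⟩, h3⟩ v <;> try rfl
    all_goals
      simp only [Bool.false_eq_true, if_true, if_false] at h1 h2 h3
      have hx : zCoord x ≠ 0 :=
        zCoord_ne_zero (mem_chartW_source.1 (by assumption)) (mem_chartZ_source.1 (by assumption))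
      simp [zpow_neg, zpow_ne_zero, hx]

instance (n : ℤ) : (lineBundleCore n).IsContMDiff 𝓘(ℂ) ω where
  contMDiffOn_coordChange := by
    rintro (_ | _) (_ | _)
    · exact contMDiffOn_const
    · exact contMDiffOn_zCoord_zpow (-n)
    · have h := contMDiffOn_zCoord_zpow n
      rw [Set.inter_comm] at h
      exact h
    · exact contMDiffOn_const

/-- The line bundle `O(n)`. -/
abbrev HolBundle.O (n : ℤ) : HolBundle 1 where
  Model := ℂ
  Fiber := (lineBundleCore n).Fiber
  finrank_model := finrank_self ℂ

/-- The trivial bundle of rank `r`. -/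
abbrev HolBundle.trivial (r : ℕ) : HolBundle r where
  Model := Fin r → ℂ
  Fiber := Bundle.Trivial CP1 (Fin r → ℂ)
  fiberGroup := fun _ => inferInstanceAs (AddCommGroup (Fin r → ℂ))
  finrank_model := by simp

/-- The direct sum of two bundles. -/
abbrev HolBundle.directSum {r s : ℕ} (E : HolBundle r) (E' : HolBundle s) : HolBundle (r + s) where
  Model := E.Model × E'.Model
  Fiber := E.Fiber ×ᵇ E'.Fiber
  fiberGroup := fun x => inferInstanceAs (AddCommGroup (E.Fiber x × E'.Fiber x))
  finrank_model := by rw [finrank_prod, E.finrank_model, E'.finrank_model]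

/-- The inclusion of the first summand, on fibers. -/
def HolBundle.inlFiber {r s : ℕ} (E : HolBundle r) (E' : HolBundle s) (x : CP1) :
    E.Fiber x →ₗ[ℂ] (E.directSum E').Fiber x where
  toFun := fun v => ((v, 0) : E.Fiber x × E'.Fiber x)
  map_add' := fun v w => (LinearMap.inl ℂ (E.Fiber x) (E'.Fiber x)).map_add v w
  map_smul' := fun c v => (LinearMap.inl ℂ (E.Fiber x) (E'.Fiber x)).map_smul c v

/-- The inclusion of the second summand, on fibers. -/
def HolBundle.inrFiber {r s : ℕ} (E : HolBundle r) (E' : HolBundle s) (x : CP1) :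
    E'.Fiber x →ₗ[ℂ] (E.directSum E').Fiber x where
  toFun := fun v => ((0, v) : E.Fiber x × E'.Fiber x)
  map_add' := fun v w => (LinearMap.inr ℂ (E.Fiber x) (E'.Fiber x)).map_add v w
  map_smul' := fun c v => (LinearMap.inr ℂ (E.Fiber x) (E'.Fiber x)).map_smul c v

theorem HolBundle.inlFiber_injective {r s : ℕ} (E : HolBundle r) (E' : HolBundle s) (x : CP1) :
    Function.Injective (E.inlFiber E' x) := fun _ _ h => congrArg Prod.fst h

theorem HolBundle.inrFiber_injective {r s : ℕ} (E : HolBundle r) (E' : HolBundle s) (x : CP1) :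
    Function.Injective (E.inrFiber E' x) := fun _ _ h => congrArg Prod.snd h

/-! ### The determinant bundle and the degree -/

/-- The determinant bundle `⋀ ^ r E` is trivial: it has a nowhere vanishing holomorphic section, that
is, a section which near every point has the form `e₁ ∧ ⋯ ∧ e_r` for some holomorphic frame. -/
def HolBundle.HasTrivialDet {r : ℕ} (E : HolBundle r) : Prop :=
  ∃ σ : ∀ x, ⋀[ℂ]^r (E.Fiber x), ∀ x, ∃ U : Set CP1, IsOpen U ∧ x ∈ U ∧
    ∃ e : Fin r → ∀ y, E.Fiber y, E.IsFrame e U ∧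
      ∀ y ∈ U, σ y = exteriorPower.ιMulti ℂ r (fun i => e i y)

/-- The section `σ` of the determinant bundle of `E` is meromorphic at `x`, and its order of vanishing
there is the integer `k`: in a punctured neighborhood of `x` it is `f · (e₁ ∧ ⋯ ∧ e_r)`, where `e` is
a holomorphic frame near `x`, and `f` is meromorphic at `x` of order `k`. -/
def HolBundle.HasDetOrder {r : ℕ} (E : HolBundle r) (σ : ∀ x, ⋀[ℂ]^r (E.Fiber x)) (x : CP1)
    (k : ℤ) : Prop :=
  ∃ U : Set CP1, IsOpen U ∧ x ∈ U ∧ ∃ e : Fin r → ∀ y, E.Fiber y, E.IsFrame e U ∧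
    ∃ f : CP1 → ℂ, MeromorphicAt (f ∘ (chartAt ℂ x).symm) (chartAt ℂ x x) ∧
      meromorphicOrderAt (f ∘ (chartAt ℂ x).symm) (chartAt ℂ x x) = (k : WithTop ℤ) ∧
      ∀ y ∈ U, y ≠ x → σ y = f y • exteriorPower.ιMulti ℂ r (fun i => e i y)

/-- `d` is the degree of the divisor of a nonzero meromorphic section of the determinant bundle. -/
def HolBundle.HasDegree {r : ℕ} (E : HolBundle r) (d : ℤ) : Prop :=
  ∃ (σ : ∀ x, ⋀[ℂ]^r (E.Fiber x)) (D : CP1 → ℤ), (∀ x, E.HasDetOrder σ x (D x)) ∧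
    ∑ᶠ x, D x = d

/-- The degree of `E`: the degree of the divisor of any nonzero meromorphic section of the determinant
bundle of `E`. -/
def HolBundle.deg {r : ℕ} (E : HolBundle r) : ℤ := Classical.epsilon E.HasDegree

/-- The rank 2 bundle `E` has Hecke length `k`, that is, `E ≅ O(a) ⊕ O(b)` with `k = |a - b|`. -/
def HolBundle.HasHeckeLength (E : HolBundle 2) (k : ℕ) : Prop :=
  ∃ a b : ℤ, Nonempty (HolIso E ((HolBundle.O a).directSum (HolBundle.O b))) ∧ k = (a - b).natAbs

/-! ### Parabolic bundles -/

/-- A rank 2 parabolic bundle with marked points `pt i`: a rank 2 holomorphic vector bundle with a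
line in the fiber over each marked point. -/
structure ParBundle {ι : Type} (pt : ι → CP1) where
  /-- the underlying vector bundle -/
  bundle : HolBundle 2
  /-- the lines -/
  line : ∀ i, Submodule ℂ (bundle.Fiber (pt i))
  finrank_line : ∀ i, finrank ℂ (line i) = 1

/-- An isomorphism of parabolic bundles. -/
structure ParIso {ι : Type} {pt : ι → CP1} (P P' : ParBundle pt) extends
    HolIso P.bundle P'.bundle where
  map_line : ∀ i, (P.line i).map (hom.onFiber (pt i)) = P'.line i

/-- A line subbundle of `E`, presented as a line bundle `L` with a fiberwise injective holomorphic
bundle map `L → E`. -/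
structure LineSub {r : ℕ} (E : HolBundle r) where
  /-- the line bundle -/
  L : HolBundle 1
  /-- its inclusion -/
  incl : HolHom L E
  injective : ∀ x, Function.Injective (incl.onFiber x)

namespace ParBundle

variable {ι : Type} {pt : ι → CP1}

open Classical in
/-- The sign `σ i` of the induced parabolic structure on a line subbundle `L`: it is `+1` if
the fiber of `L` at the marked point `pt i` is the parabolic line, and `-1` otherwise. -/
def sign (P : ParBundle pt) (L : LineSub P.bundle) (i : ι) : ℤ :=
  if LinearMap.range (L.incl.onFiber (pt i)) = P.line i then 1 else -1

/-- The parabolic slope of the parabolic subbundle `(L, σ)`, for the weights `± μ`. -/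
def subSlope [Fintype ι] (μ : ℝ) (P : ParBundle pt) (L : LineSub P.bundle) : ℝ :=
  L.L.deg + μ * ∑ i, (P.sign L i : ℝ)

/-- The parabolic slope of a rank 2 parabolic bundle; the weights `μ` and `-μ` cancel. -/
def slope (P : ParBundle pt) : ℝ := P.bundle.deg / 2

/-- Parabolic stability with respect to the weights `± μ`. -/
def IsStable [Fintype ι] (μ : ℝ) (P : ParBundle pt) : Prop :=
  ∀ L : LineSub P.bundle, P.subSlope μ L < P.slope

/-- Parabolic semistability with respect to the weights `± μ`. -/
def IsSemistable [Fintype ι] (μ : ℝ) (P : ParBundle pt) : Prop :=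
  ∀ L : LineSub P.bundle, P.subSlope μ L ≤ P.slope

open Classical in
/-- The parabolic bundle `(L, σ) ⊕ (Q, -σ)`, where `Q` is meant to be the quotient bundle `E / L`: the
line at the `i`-th marked point is the fiber of `L` if `σ i = 1`, and the fiber of `Q` if not. -/
def graded (P : ParBundle pt) (L : LineSub P.bundle) (Q : HolBundle 1) : ParBundle pt where
  bundle := L.L.directSum Q
  line := fun i =>
    if P.sign L i = 1 then LinearMap.range (L.L.inlFiber Q (pt i))
    else LinearMap.range (L.L.inrFiber Q (pt i))
  finrank_line := by
    intro i
    have key : ∀ M : Submodule ℂ ((L.L.directSum Q).Fiber (pt i)),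
        M = LinearMap.range (L.L.inlFiber Q (pt i)) ∨
          M = LinearMap.range (L.L.inrFiber Q (pt i)) → finrank ℂ M = 1 := by
      rintro _ (rfl | rfl)
      · exact (LinearMap.finrank_range_of_inj (L.L.inlFiber_injective Q (pt i))).trans
          (L.L.finrank_fiber (pt i))
      · exact (LinearMap.finrank_range_of_inj (L.L.inrFiber_injective Q (pt i))).trans
          (Q.finrank_fiber (pt i))
    apply key
    by_cases h : P.sign L i = 1
    · exact Or.inl (if_pos h)
    · exact Or.inr (if_neg h)

/-- `G` is isomorphic to the associated graded parabolic bundle of the semistable parabolic bundle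
`P`: either `P` is stable and `G ≅ P`, or there is an exact sequence `0 → L → E → Q → 0`, with `L` a
parabolic subbundle of the same parabolic slope as `P`, and `G ≅ (L, σ) ⊕ (Q, -σ)`. -/
def IsAssocGraded [Fintype ι] (μ : ℝ) (P G : ParBundle pt) : Prop :=
  (P.IsStable μ ∧ Nonempty (ParIso P G)) ∨
    ∃ (L : LineSub P.bundle) (Q : HolBundle 1) (ρ : HolHom P.bundle Q),
      (∀ x, Function.Surjective (ρ.onFiber x)) ∧
      (∀ x, LinearMap.ker (ρ.onFiber x) = LinearMap.range (L.incl.onFiber x)) ∧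
      P.subSlope μ L = P.slope ∧ Nonempty (ParIso (P.graded L Q) G)

/-- `S`-equivalence of semistable parabolic bundles: the associated graded bundles are isomorphic. -/
def SEquiv [Fintype ι] (μ : ℝ) (P P' : ParBundle pt) : Prop :=
  ∃ G : ParBundle pt, P.IsAssocGraded μ G ∧ P'.IsAssocGraded μ G

end ParBundle

/-- The semistable rank 2 parabolic bundles with trivial determinant bundle. -/
structure SemistablePar (μ : ℝ) {ι : Type} [Fintype ι] (pt : ι → CP1) extends ParBundle pt where
  trivialDet : bundle.HasTrivialDet
  semistable : toParBundle.IsSemistable μ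

/-- The moduli space `M^ss` of semistable rank 2 parabolic bundles with marked points `pt` and with
trivial determinant bundle, modulo `S`-equivalence. -/
def Mss (μ : ℝ) {ι : Type} [Fintype ι] (pt : ι → CP1) : Type 1 :=
  Quot fun P P' : SemistablePar μ pt => P.toParBundle.SEquiv μ P'.toParBundle

/-! ### Hecke modifications -/

/-- The bundle map `α : F → E` is a Hecke modification of `E` at `p`: it is an isomorphism on the
fibers away from `p`, and on a neighborhood of `p`, for a suitable local coordinate `ξ` and suitable
holomorphic frames, it is given by the matrix `diag (1, ξ - ξ(p))`. -/
def IsHecke {E F : HolBundle 2} (α : HolHom F E) (p : CP1) : Prop :=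
  (∀ x, x ≠ p → Function.Bijective (α.onFiber x)) ∧
  ∃ ξ ∈ IsManifold.maximalAtlas 𝓘(ℂ) ω CP1, p ∈ ξ.source ∧
    ∃ (e : Fin 2 → ∀ x, E.Fiber x) (f : Fin 2 → ∀ x, F.Fiber x),
      E.IsFrame e ξ.source ∧ F.IsFrame f ξ.source ∧
      ∀ x ∈ ξ.source, α.onFiber x (f 0 x) = e 0 x ∧ α.onFiber x (f 1 x) = (ξ x - ξ p) • e 1 x

/-- A sequence of Hecke modifications `E₀ ← E₁ ← ⋯ ← E_n` at the points `p`. -/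
structure HeckeSeq {n : ℕ} (p : Fin n → CP1) where
  /-- the bundles `E₀, …, E_n` -/
  bundle : Fin (n + 1) → HolBundle 2
  /-- the bundle maps -/
  α : ∀ i : Fin n, HolHom (bundle i.succ) (bundle i.castSucc)
  isHecke : ∀ i, IsHecke (α i) (p i)

namespace HeckeSeq

variable {n : ℕ} {p : Fin n → CP1}

/-- The composition `α₁ ∘ ⋯ ∘ α_i` on the fibers at `x`. -/
def comp (S : HeckeSeq p) (i : Fin (n + 1)) (x : CP1) :
    (S.bundle i).Fiber x →ₗ[ℂ] (S.bundle 0).Fiber x :=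
  Fin.induction (motive := fun i => (S.bundle i).Fiber x →ₗ[ℂ] (S.bundle 0).Fiber x)
    LinearMap.id (fun i f => f ∘ₗ (S.α i).onFiber x) i

theorem comp_succ (S : HeckeSeq p) (i : Fin n) (x : CP1) :
    S.comp i.succ x = S.comp i.castSucc x ∘ₗ (S.α i).onFiber x := rfl

/-- The line `ℓ_{p_i}` in the fiber of `E₀` at `p_i` that corresponds to the sequence: the image of
the fiber of `E_i` under `α₁ ∘ ⋯ ∘ α_i`. -/
def line (S : HeckeSeq p) (i : Fin n) : Submodule ℂ ((S.bundle 0).Fiber (p i)) :=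
  LinearMap.range (S.comp i.succ (p i))

theorem comp_injective (S : HeckeSeq p) (x : CP1) (i : Fin (n + 1))
    (h : ∀ j : Fin n, j.castSucc < i → x ≠ p j) : Function.Injective (S.comp i x) := by
  induction i using Fin.induction with
  | zero => exact Function.injective_id
  | succ i ih =>
    rw [comp_succ]
    exact (ih fun j hj => h j (hj.trans (Fin.castSucc_lt_succ))).comp
      ((S.isHecke i).1 x (h i (Fin.castSucc_lt_succ))).1

theorem finrank_range_of_isHecke {E F : HolBundle 2} {α : HolHom F E} {p : CP1}
    (h : IsHecke α p) : finrank ℂ (LinearMap.range (α.onFiber p)) = 1 := by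
  obtain ⟨-, ξ, -, hp, e, f, he, hf, hα⟩ := h
  have hr : LinearMap.range (α.onFiber p) = Submodule.span ℂ {e 0 p} := by
    have hspan : Submodule.span ℂ (Set.range fun i => f i p) = ⊤ := top_le_iff.1 (hf.generating hp)
    rw [LinearMap.range_eq_map, ← hspan, Submodule.map_span, ← Set.range_comp]
    apply le_antisymm
    · rw [Submodule.span_le]
      rintro _ ⟨i, rfl⟩
      fin_cases i
      · simp [(hα p hp).1]
      · simp [(hα p hp).2]
    · rw [Submodule.span_le]
      rintro _ rfl
      exact Submodule.subset_span ⟨0, (hα p hp).1⟩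
  rw [hr]
  exact finrank_span_singleton ((he.linearIndependent hp).ne_zero 0)

theorem finrank_line (S : HeckeSeq p) (hp : Function.Injective p) (i : Fin n) :
    finrank ℂ (S.line i) = 1 := by
  have hinj : Function.Injective (S.comp i.castSucc (p i)) :=
    S.comp_injective (p i) i.castSucc fun j hj h => by
      rw [hp h] at hj
      exact lt_irrefl _ hj
  rw [line, comp_succ, LinearMap.range_comp]
  exact (Submodule.equivMapOfInjective _ hinj _).symm.finrank_eq.trans
    (finrank_range_of_isHecke (S.isHecke i))

end HeckeSeq

/-- A sequence of Hecke modifications at the points `p` of a parabolic bundle with marked points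
`q`, that is, of `E₀` with lines `ℓ_{q_j}` in its fibers at the points `q_j`. -/
structure ParHeckeSeq {m n : ℕ} (q : Fin m → CP1) (p : Fin n → CP1) extends HeckeSeq p where
  /-- the lines at the points `q` -/
  initLine : ∀ j, Submodule ℂ ((bundle 0).Fiber (q j))
  finrank_initLine : ∀ j, finrank ℂ (initLine j) = 1

namespace ParHeckeSeq

variable {m n : ℕ} {q : Fin m → CP1} {p : Fin n → CP1}

/-- The initial parabolic bundle `(E₀, ℓ_{q_1}, …, ℓ_{q_m})`. -/
def init (S : ParHeckeSeq q p) : ParBundle q where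
  bundle := S.bundle 0
  line := S.initLine
  finrank_line := S.finrank_initLine

/-- The terminal vector bundle `E_n`. -/
def terminal (S : ParHeckeSeq q p) : HolBundle 2 := S.bundle (Fin.last n)

/-- Isomorphism of (equivalence classes of) sequences of Hecke modifications of parabolic bundles:
isomorphisms `φ i : E_i → E_i'` that commute with the Hecke modifications, the first of them
being an isomorphism of the initial parabolic bundles. -/
def Isomorphic (S S' : ParHeckeSeq q p) : Prop :=
  ∃ φ : ∀ i, HolIso (S.bundle i) (S'.bundle i),
    (∀ (i : Fin n) (x : CP1) (v : (S.bundle i.succ).Fiber x),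
      (S'.α i).onFiber x ((φ i.succ).hom.onFiber x v) =
        (φ i.castSucc).hom.onFiber x ((S.α i).onFiber x v)) ∧
    ∀ j, (S.initLine j).map ((φ 0).hom.onFiber (q j)) = S'.initLine j

/-- The parabolic bundle `(E₀, ℓ_{p_1}, …, ℓ_{p_n}, ℓ_{q_1}, …, ℓ_{q_m})`, with the marked points
indexed by `Fin n ⊕ Fin m`. -/
def toPar (S : ParHeckeSeq q p) (hpq : Function.Injective (Sum.elim p q)) :
    ParBundle (Sum.elim p q) where
  bundle := S.bundle 0
  line := fun
    | .inl i => S.line i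
    | .inr j => S.initLine j
  finrank_line := by
    rintro (i | j)
    · exact S.finrank_line (fun a b h => Sum.inl_injective (hpq h)) i
    · exact S.finrank_initLine j

end ParHeckeSeq

/-- The sequences of Hecke modifications `(E, ℓ_{q_1}, ℓ_{q_2}, ℓ_{q_3}) ← E₁ ← ⋯ ← E_n` for which
the initial parabolic bundle is stable with trivial determinant bundle, and the terminal bundle has
the minimal possible Hecke length (`0` for even `n`, and `1` for odd `n`). -/
structure HpSeq {n : ℕ} (μ : ℝ) (q : Fin 3 → CP1) (p : Fin n → CP1) extends ParHeckeSeq q p where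
  trivialDet : (bundle 0).HasTrivialDet
  stable : toParHeckeSeq.init.IsStable μ
  heckeLength : toParHeckeSeq.terminal.HasHeckeLength (n % 2)

/-- The space `H_p(CP1; q_1, q_2, q_3; p_1, …, p_n)` of isomorphism classes of such sequences. -/
def Hp {n : ℕ} (μ : ℝ) (q : Fin 3 → CP1) (p : Fin n → CP1) : Type 1 :=
  Quot fun S S' : HpSeq μ q p => S.toParHeckeSeq.Isomorphic S'.toParHeckeSeq

/-- The point of `H_p` given by a sequence. -/
def Hp.mk {n : ℕ} {μ : ℝ} {q : Fin 3 → CP1} {p : Fin n → CP1} (S : HpSeq μ q p) : Hp μ q p :=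
  Quot.mk _ S

/-- The point of `M^ss` given by a semistable parabolic bundle with trivial determinant bundle. -/
def Mss.mk {μ : ℝ} {ι : Type} [Fintype ι] {pt : ι → CP1} (P : ParBundle pt)
    (hdet : P.bundle.HasTrivialDet) (hss : P.IsSemistable μ) : Mss μ pt :=
  Quot.mk _ ⟨P, hdet, hss⟩

end

end HeckeEmbedding

open HeckeEmbedding

/-!
A sequence of Hecke modifications `E₀ ← E₁ ← ⋯ ← E_n` at distinct points is the same thing as `E₀`
together with its lines `ℓ_i` at the points `p i`: a Hecke modification at `p` identifies `F` with the
subsheaf of `E` of the sections whose value at `p` lies in a line, so an isomorphism `E₀ ≅ E₀'` that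
matches the lines lifts step by step (`HeckeSeq.exists_iso`). Holomorphy of the lift over `p` is the
removable singularity theorem: a holomorphic function that vanishes at `p` is divisible by the local
coordinate (`HolAt.exists_eq_mul`, `IsHecke.exists_lift`).

Since `n + 3` is odd and the weight is small, no line subbundle of a bundle of degree `0` has parabolic
slope `0` (`ParBundle.subSlope_ne_slope`). So semistable parabolic bundles are stable, `S`-equivalence
is isomorphism (`Mss.nonempty_parIso`), and the map is well defined and injective as soon as its values
are semistable.

Semistability, and the bound on the number of equal lines, both follow from the inequality
`deg L + #{i | L_{p i} = ℓ_i} ≤ n / 2` for line subbundles `L` of `E₀` (`LineSub.exists_hasDegree_le`).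
Each Hecke modification lowers the degree by `1`, so `E_n ≅ O(m) ⊕ O(m)` with `2 m = -n`. The inclusion
of `L` lifts to a meromorphic map from `L` to `E_n` with at most simple poles, at the points `p i` with
`L_{p i} ≠ ℓ_i`. One of its two components `L → O(m)` is not zero, by the identity theorem, and a
nonzero meromorphic map `L → O(m)` shows that `deg L` is at most `m` plus the number of the poles. The
same map pulls back a meromorphic section of `O(m)` to one of `L`, so that `L` does have a degree.

The degree is well defined because the quotient of two meromorphic sections of a determinant bundle is
a meromorphic function on the sphere, whose divisor has degree `0` (`HasOrd.finsum_eq_zero`): after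
division by its zeros and poles in the affine line, either it or its inverse would tend to `0` at
infinity, unless its order there is `0`, and this contradicts Liouville's theorem.
-/

namespace HeckeEmbedding

noncomputable section

open Filter

/-! ### Holomorphic functions on the sphere -/

/-- The function `g` is holomorphic near `x`. -/
abbrev HolAt (g : CP1 → ℂ) (x : CP1) : Prop := ContMDiffAt 𝓘(ℂ) 𝓘(ℂ) ω g x

theorem holAt_iff_analyticAt {ξ : OpenPartialHomeomorph CP1 ℂ}
    (hξ : ξ ∈ IsManifold.maximalAtlas 𝓘(ℂ) ω CP1) {x : CP1} (hx : x ∈ ξ.source) {g : CP1 → ℂ} :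
    HolAt g x ↔ AnalyticAt ℂ (g ∘ ξ.symm) (ξ x) := by
  constructor
  · intro h
    have h1 : ContMDiffAt 𝓘(ℂ) 𝓘(ℂ) ω ξ.symm (ξ x) :=
      contMDiffAt_symm_of_mem_maximalAtlas hξ (ξ.map_source hx)
    have h2 : ContMDiffAt 𝓘(ℂ) 𝓘(ℂ) ω (g ∘ ξ.symm) (ξ x) := by
      refine ContMDiffAt.comp (ξ x) ?_ h1
      rwa [ξ.left_inv hx]
    exact h2.contDiffAt.analyticAt
  · intro h
    have h1 : ContMDiffAt 𝓘(ℂ) 𝓘(ℂ) ω ξ x := contMDiffAt_of_mem_maximalAtlas hξ hx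
    have h2 : ContMDiffAt 𝓘(ℂ) 𝓘(ℂ) ω ((g ∘ ξ.symm) ∘ ξ) x :=
      ContMDiffAt.comp x h.contDiffAt.contMDiffAt h1
    refine h2.congr_of_eventuallyEq ?_
    filter_upwards [ξ.open_source.mem_nhds hx] with y hy
    simp [ξ.left_inv hy]

/-- The local coordinate at `x` that vanishes at `x`. -/
def localCoord (x y : CP1) : ℂ := chartAt ℂ x y - chartAt ℂ x x

theorem chartAt_mem_maximalAtlas (x : CP1) : chartAt ℂ x ∈ IsManifold.maximalAtlas 𝓘(ℂ) ω CP1 :=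
  IsManifold.chart_mem_maximalAtlas x

theorem holAt_chart_sub {ξ : OpenPartialHomeomorph CP1 ℂ}
    (hξ : ξ ∈ IsManifold.maximalAtlas 𝓘(ℂ) ω CP1) {x : CP1} (hx : x ∈ ξ.source) (c : ℂ) :
    HolAt (fun y => ξ y - c) x :=
  (contMDiffAt_of_mem_maximalAtlas hξ hx).sub contMDiffAt_const

theorem eventually_chart_ne {ξ : OpenPartialHomeomorph CP1 ℂ} {x : CP1} (hx : x ∈ ξ.source) :
    ∀ᶠ y in 𝓝[≠] x, ξ y - ξ x ≠ 0 := by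
  filter_upwards [mem_nhdsWithin_of_mem_nhds (ξ.open_source.mem_nhds hx), self_mem_nhdsWithin]
    with y hy hyx h
  exact hyx (ξ.injOn hy hx (sub_eq_zero.1 h))

theorem eventually_localCoord_ne (x : CP1) : ∀ᶠ y in 𝓝[≠] x, localCoord x y ≠ 0 :=
  eventually_chart_ne (mem_chart_source ℂ x)

/-- Removable singularities: a holomorphic function that vanishes at `x` is divisible by any local
coordinate that vanishes at `x`. -/
theorem HolAt.exists_eq_mul {ξ : OpenPartialHomeomorph CP1 ℂ}
    (hξ : ξ ∈ IsManifold.maximalAtlas 𝓘(ℂ) ω CP1) {x : CP1} (hx : x ∈ ξ.source) {g : CP1 → ℂ}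
    (hg : HolAt g x) (h0 : g x = 0) :
    ∃ u : CP1 → ℂ, HolAt u x ∧ ∀ᶠ y in 𝓝 x, g y = (ξ y - ξ x) * u y := by
  rw [holAt_iff_analyticAt hξ hx] at hg
  refine ⟨dslope (g ∘ ξ.symm) (ξ x) ∘ ξ, ?_, ?_⟩
  · rw [holAt_iff_analyticAt hξ hx]
    obtain ⟨p, hp⟩ := hg
    have h1 : AnalyticAt ℂ (dslope (g ∘ ξ.symm) (ξ x)) (ξ x) := ⟨_, hp.has_fpower_series_dslope_fslope⟩
    refine h1.congr ?_
    filter_upwards [ξ.open_target.mem_nhds (ξ.map_source hx)] with z hz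
    simp [ξ.right_inv hz]
  · filter_upwards [ξ.open_source.mem_nhds hx] with y hy
    have h1 := sub_smul_dslope (g ∘ ξ.symm) (ξ x) (ξ y)
    simp only [Function.comp_apply, ξ.left_inv hy, ξ.left_inv hx, h0, sub_zero, smul_eq_mul] at h1
    simp [h1]

theorem HolAt.mul {f g : CP1 → ℂ} {x : CP1} (hf : HolAt f x) (hg : HolAt g x) :
    HolAt (fun y => f y * g y) x := ContMDiffAt.smul hf hg

theorem HolAt.inv {f : CP1 → ℂ} {x : CP1} (hf : HolAt f x) (h0 : f x ≠ 0) :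
    HolAt (fun y => (f y)⁻¹) x := by
  have h1 : ContMDiffAt 𝓘(ℂ) 𝓘(ℂ) ω (fun z : ℂ => z⁻¹) (f x) :=
    (contDiffAt_inv ℂ h0).contMDiffAt
  exact ContMDiffAt.comp (g := fun z : ℂ => z⁻¹) x h1 hf

theorem HolAt.eventually {f : CP1 → ℂ} {x : CP1} (hf : HolAt f x) : ∀ᶠ y in 𝓝 x, HolAt f y := by
  have hx := mem_chart_source ℂ x
  have h := ((holAt_iff_analyticAt (chartAt_mem_maximalAtlas x) hx).1 hf).eventually_analyticAt
  filter_upwards [((chartAt ℂ x).continuousAt hx).eventually h,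
    (chartAt ℂ x).open_source.mem_nhds hx] with y hy hys
  exact (holAt_iff_analyticAt (chartAt_mem_maximalAtlas x) hys).2 hy

theorem HolAt.eventually_ne {f : CP1 → ℂ} {x : CP1} (hf : HolAt f x) (h0 : f x ≠ 0) :
    ∀ᶠ y in 𝓝 x, f y ≠ 0 := hf.continuousAt.eventually_ne h0

/-! ### Orders of meromorphic functions on the sphere -/

/-- The function `f` is meromorphic at `x`, of order `k`. -/
def HasOrd (f : CP1 → ℂ) (x : CP1) (k : ℤ) : Prop :=
  MeromorphicAt (f ∘ (chartAt ℂ x).symm) (chartAt ℂ x x) ∧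
    meromorphicOrderAt (f ∘ (chartAt ℂ x).symm) (chartAt ℂ x x) = (k : WithTop ℤ)

theorem tendsto_chart_nhdsNE {ξ : OpenPartialHomeomorph CP1 ℂ} {x : CP1} (hx : x ∈ ξ.source) :
    Tendsto ξ (𝓝[≠] x) (𝓝[≠] (ξ x)) := by
  refine tendsto_nhdsWithin_iff.2 ⟨(ξ.continuousAt hx).mono_left nhdsWithin_le_nhds, ?_⟩
  filter_upwards [eventually_chart_ne hx] with y hy
  exact sub_ne_zero.1 hy

theorem tendsto_chart_symm_nhdsNE {ξ : OpenPartialHomeomorph CP1 ℂ} {x : CP1} (hx : x ∈ ξ.source) :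
    Tendsto ξ.symm (𝓝[≠] (ξ x)) (𝓝[≠] x) := by
  refine tendsto_nhdsWithin_iff.2 ⟨?_, ?_⟩
  · have := (ξ.symm.continuousAt (x := ξ x) (ξ.map_source hx)).tendsto
    rw [ξ.left_inv hx] at this
    exact this.mono_left nhdsWithin_le_nhds
  · filter_upwards [mem_nhdsWithin_of_mem_nhds (ξ.open_target.mem_nhds (ξ.map_source hx)),
      self_mem_nhdsWithin] with z hz hzx h
    apply hzx
    rw [Set.mem_singleton_iff] at h ⊢
    rw [← h, ξ.right_inv hz]

theorem hasOrd_iff {f : CP1 → ℂ} {x : CP1} {k : ℤ} :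
    HasOrd f x k ↔ ∃ u : CP1 → ℂ, HolAt u x ∧ u x ≠ 0 ∧
      ∀ᶠ y in 𝓝[≠] x, f y = localCoord x y ^ k * u y := by
  have hx := mem_chart_source ℂ x
  constructor
  · rintro ⟨h1, h2⟩
    rw [meromorphicOrderAt_eq_int_iff h1] at h2
    obtain ⟨g, hg, hg0, h⟩ := h2
    refine ⟨g ∘ chartAt ℂ x, ?_, hg0, ?_⟩
    · exact ContMDiffAt.comp x hg.contDiffAt.contMDiffAt
        (contMDiffAt_of_mem_maximalAtlas (chartAt_mem_maximalAtlas x) hx)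
    · filter_upwards [(tendsto_chart_nhdsNE hx).eventually h,
        mem_nhdsWithin_of_mem_nhds ((chartAt ℂ x).open_source.mem_nhds hx)] with y hy hys
      simpa [(chartAt ℂ x).left_inv hys] using! hy
  · rintro ⟨u, hu, hu0, h⟩
    have h3 : ∀ᶠ z in 𝓝[≠] (chartAt ℂ x x), (f ∘ (chartAt ℂ x).symm) z =
        (z - chartAt ℂ x x) ^ k • (u ∘ (chartAt ℂ x).symm) z := by
      filter_upwards [(tendsto_chart_symm_nhdsNE hx).eventually h, mem_nhdsWithin_of_mem_nhds
        ((chartAt ℂ x).open_target.mem_nhds ((chartAt ℂ x).map_source hx))] with z hz hzt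
      simpa [localCoord, (chartAt ℂ x).right_inv hzt] using! hz
    have h4 := (holAt_iff_analyticAt (chartAt_mem_maximalAtlas x) hx).1 hu
    have h5 : MeromorphicAt (f ∘ (chartAt ℂ x).symm) (chartAt ℂ x x) :=
      MeromorphicAt.iff_eventuallyEq_zpow_smul_analyticAt.2 ⟨k, _, h4, h3⟩
    refine ⟨h5, (meromorphicOrderAt_eq_int_iff h5).2 ⟨_, h4, ?_, h3⟩⟩
    simpa [(chartAt ℂ x).left_inv hx] using hu0

theorem HasOrd.unique {f : CP1 → ℂ} {x : CP1} {k l : ℤ} (h : HasOrd f x k) (h' : HasOrd f x l) :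
    k = l := by
  have := h.2.symm.trans h'.2
  exact_mod_cast this

theorem HasOrd.congr {f g : CP1 → ℂ} {x : CP1} {k : ℤ} (h : HasOrd f x k)
    (hfg : ∀ᶠ y in 𝓝[≠] x, g y = f y) : HasOrd g x k := by
  obtain ⟨u, hu, hu0, h⟩ := hasOrd_iff.1 h
  refine hasOrd_iff.2 ⟨u, hu, hu0, ?_⟩
  filter_upwards [h, hfg] with y h1 h2
  rw [h2, h1]

theorem HasOrd.mul {f g : CP1 → ℂ} {x : CP1} {k l : ℤ} (hf : HasOrd f x k) (hg : HasOrd g x l) :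
    HasOrd (fun y => f y * g y) x (k + l) := by
  obtain ⟨u, hu, hu0, h⟩ := hasOrd_iff.1 hf
  obtain ⟨v, hv, hv0, h'⟩ := hasOrd_iff.1 hg
  refine hasOrd_iff.2 ⟨fun y => u y * v y, hu.mul hv, mul_ne_zero hu0 hv0, ?_⟩
  filter_upwards [h, h', eventually_localCoord_ne x] with y h1 h2 h3
  rw [h1, h2, zpow_add₀ h3]
  ring

theorem HasOrd.inv {f : CP1 → ℂ} {x : CP1} {k : ℤ} (hf : HasOrd f x k) :
    HasOrd (fun y => (f y)⁻¹) x (-k) := by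
  obtain ⟨u, hu, hu0, h⟩ := hasOrd_iff.1 hf
  refine hasOrd_iff.2 ⟨fun y => (u y)⁻¹, hu.inv hu0, inv_ne_zero hu0, ?_⟩
  filter_upwards [h] with y h1
  rw [h1, mul_inv, zpow_neg]

theorem HasOrd.div {f g : CP1 → ℂ} {x : CP1} {k l : ℤ} (hf : HasOrd f x k) (hg : HasOrd g x l) :
    HasOrd (fun y => f y / g y) x (k - l) := by
  simpa only [div_eq_mul_inv, sub_eq_add_neg] using hf.mul hg.inv

theorem HolAt.hasOrd_zero {f : CP1 → ℂ} {x : CP1} (hf : HolAt f x) (h0 : f x ≠ 0) :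
    HasOrd f x 0 :=
  hasOrd_iff.2 ⟨f, hf, h0, by simp⟩

theorem HasOrd.zpow {f : CP1 → ℂ} {x : CP1} {k : ℤ} (hf : HasOrd f x k) (l : ℤ) :
    HasOrd (fun y => f y ^ l) x (l * k) := by
  have hnat : ∀ m : ℕ, HasOrd (fun y => f y ^ m) x (m * k) := by
    intro m
    induction m with
    | zero => simpa using HolAt.hasOrd_zero (contMDiffAt_const (c := (1 : ℂ))) (by simp)
    | succ m ih =>
      have := ih.mul hf
      simp only [← pow_succ] at this
      convert! this using 1
      push_cast
      ring
  obtain ⟨m, rfl | rfl⟩ := l.eq_nat_or_neg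
  · simpa using hnat m
  · simpa using (hnat m).inv

theorem HasOrd.prod {ι : Type*} {s : Finset ι} {f : ι → CP1 → ℂ} {x : CP1} {k : ι → ℤ}
    (h : ∀ i ∈ s, HasOrd (f i) x (k i)) : HasOrd (fun y => ∏ i ∈ s, f i y) x (∑ i ∈ s, k i) := by
  classical
  induction s using Finset.induction_on with
  | empty => simpa using HolAt.hasOrd_zero (contMDiffAt_const (c := (1 : ℂ))) (by simp)
  | insert a s ha ih =>
    simp only [Finset.prod_insert ha, Finset.sum_insert ha]
    exact (h a (by simp)).mul (ih fun i hi => h i (by simp [hi]))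

theorem HasOrd.eventually {f : CP1 → ℂ} {x : CP1} {k : ℤ} (hf : HasOrd f x k) :
    ∀ᶠ y in 𝓝[≠] x, HolAt f y ∧ f y ≠ 0 := by
  obtain ⟨u, hu, hu0, h⟩ := hasOrd_iff.1 hf
  have h1 : ∀ᶠ y in 𝓝 x, HolAt (localCoord x) y := HolAt.eventually
    (holAt_chart_sub (chartAt_mem_maximalAtlas x) (mem_chart_source ℂ x) _)
  have h2 : ∀ᶠ y in 𝓝[≠] x, ∀ᶠ w in 𝓝 y, f w = localCoord x w ^ k * u w := by
    have := eventually_eventually_nhdsWithin.2 h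
    filter_upwards [this, self_mem_nhdsWithin] with y hy hyx
    rwa [IsOpen.nhdsWithin_eq isOpen_compl_singleton hyx] at hy
  filter_upwards [h2, eventually_localCoord_ne x, mem_nhdsWithin_of_mem_nhds h1,
    mem_nhdsWithin_of_mem_nhds hu.eventually, mem_nhdsWithin_of_mem_nhds (hu.eventually_ne hu0)]
    with y h3 h4 h5 h6 h7
  refine ⟨?_, ?_⟩
  · have h8 : HolAt (fun w => localCoord x w ^ k) y := by
      have h9 : ContMDiffAt 𝓘(ℂ) 𝓘(ℂ) ω (fun z : ℂ => z ^ k) (localCoord x y) :=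
        ((analyticAt_id (𝕜 := ℂ)).zpow h4).contDiffAt.contMDiffAt
      exact ContMDiffAt.comp (g := fun z : ℂ => z ^ k) y h9 h5
    exact (h8.mul h6).congr_of_eventuallyEq h3
  · rw [h3.self_of_nhds]
    exact mul_ne_zero (zpow_ne_zero _ h4) h7

/-- A holomorphic function has a nonnegative order, unless it vanishes near the point. -/
theorem HolAt.exists_hasOrd {f : CP1 → ℂ} {x : CP1} (hf : HolAt f x)
    (h : ¬ ∀ᶠ y in 𝓝[≠] x, f y = 0) : ∃ k : ℤ, 0 ≤ k ∧ HasOrd f x k := by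
  have hx := mem_chart_source ℂ x
  have ha := (holAt_iff_analyticAt (chartAt_mem_maximalAtlas x) hx).1 hf
  have hm := ha.meromorphicAt
  have htop : meromorphicOrderAt (f ∘ (chartAt ℂ x).symm) (chartAt ℂ x x) ≠ ⊤ := by
    rw [Ne, meromorphicOrderAt_eq_top_iff]
    intro h1
    apply h
    filter_upwards [(tendsto_chart_nhdsNE hx).eventually h1,
      mem_nhdsWithin_of_mem_nhds ((chartAt ℂ x).open_source.mem_nhds hx)] with y hy hys
    simpa [(chartAt ℂ x).left_inv hys] using! hy
  obtain ⟨k, hk⟩ := WithTop.ne_top_iff_exists.1 htop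
  refine ⟨k, ?_, hm, hk.symm⟩
  have := ha.meromorphicOrderAt_nonneg
  rw [← hk] at this
  exact_mod_cast this

theorem hasOrd_chart_sub {ξ : OpenPartialHomeomorph CP1 ℂ}
    (hξ : ξ ∈ IsManifold.maximalAtlas 𝓘(ℂ) ω CP1) {x : CP1} (hx : x ∈ ξ.source) :
    HasOrd (fun y => ξ y - ξ x) x 1 := by
  have hx' := mem_chart_source ℂ x
  have hc := chartAt_mem_maximalAtlas x
  obtain ⟨u, hu, h1⟩ := (holAt_chart_sub hξ hx (ξ x)).exists_eq_mul hc hx' (sub_self _)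
  obtain ⟨v, hv, h2⟩ := (holAt_chart_sub hc hx' (chartAt ℂ x x)).exists_eq_mul hξ hx (sub_self _)
  refine hasOrd_iff.2 ⟨u, hu, ?_, ?_⟩
  · have h3 : ∀ᶠ y in 𝓝[≠] x, u y * v y = 1 := by
      filter_upwards [mem_nhdsWithin_of_mem_nhds h1, mem_nhdsWithin_of_mem_nhds h2,
        eventually_chart_ne hx] with y h4 h5 h6
      rw [h5] at h4
      have : (ξ y - ξ x) * (u y * v y) = (ξ y - ξ x) * 1 := by linear_combination -h4
      exact mul_left_cancel₀ h6 this
    have h4 : Tendsto (fun y => u y * v y) (𝓝[≠] x) (𝓝 (u x * v x)) :=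
      (hu.mul hv).continuousAt.tendsto.mono_left nhdsWithin_le_nhds
    have h5 : u x * v x = 1 := tendsto_nhds_unique (h4.congr' h3) tendsto_const_nhds
    exact left_ne_zero_of_mul_eq_one h5
  · filter_upwards [mem_nhdsWithin_of_mem_nhds h1] with y h4
    rw [h4, zpow_one]
    rfl

theorem hasOrd_localCoord (x : CP1) : HasOrd (localCoord x) x 1 :=
  hasOrd_chart_sub (chartAt_mem_maximalAtlas x) (mem_chart_source ℂ x)

/-- A property that holds near every point, except possibly at the point, fails only finitely often. -/
theorem finite_of_forall_eventually {p : CP1 → Prop} (h : ∀ x, ∀ᶠ y in 𝓝[≠] x, ¬ p y) :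
    {x | p x}.Finite := by
  by_contra hinf
  obtain ⟨x, hx⟩ := Set.Infinite.exists_accPt_principal (s := {x | p x}) hinf
  rw [accPt_iff_frequently] at hx
  have := h x
  rw [eventually_nhdsWithin_iff] at this
  exact hx (this.mono fun y h1 h2 => h1 h2.1 h2.2)

theorem chartAt_coe (z : ℂ) : chartAt ℂ (z : CP1) = chartZ := by
  classical
  exact if_neg (OnePoint.coe_ne_infty z)

theorem chartAt_infty : chartAt ℂ (OnePoint.infty : CP1) = chartW := by
  classical
  exact if_pos rfl

theorem hasOrd_zCoord_sub_coe (u z : ℂ) :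
    HasOrd (fun y => zCoord y - u) (z : CP1) (if u = z then 1 else 0) := by
  have h := chartAt_mem_maximalAtlas (z : CP1)
  rw [chartAt_coe] at h
  have hz : (z : CP1) ∈ chartZ.source := by rw [mem_chartZ_source]; simp
  split_ifs with huz
  · subst huz
    exact hasOrd_chart_sub h hz
  · refine (holAt_chart_sub h hz u).hasOrd_zero ?_
    change z - u ≠ 0
    exact sub_ne_zero.2 (Ne.symm huz)

theorem hasOrd_wCoord_infty : HasOrd wCoord OnePoint.infty 1 := by
  refine (hasOrd_localCoord OnePoint.infty).congr (Eventually.of_forall fun y => ?_)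
  simp only [localCoord, chartAt_infty, chartW_apply]
  simp [wCoord]

theorem eventually_ne_infty_coe (z : ℂ) : ∀ᶠ y in 𝓝[≠] (OnePoint.infty : CP1), y ≠ (z : CP1) :=
  mem_nhdsWithin_of_mem_nhds (isOpen_ne.mem_nhds (OnePoint.infty_ne_coe z))

theorem holAt_wCoord_infty : HolAt wCoord OnePoint.infty := by
  have h := chartAt_mem_maximalAtlas OnePoint.infty
  rw [chartAt_infty] at h
  have h1 := holAt_chart_sub h (x := OnePoint.infty) (mem_chartW_source.2 (OnePoint.infty_ne_coe 0)) 0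
  simpa only [chartW_apply, sub_zero] using h1

theorem hasOrd_zCoord_sub_infty (u : ℂ) :
    HasOrd (fun y => zCoord y - u) OnePoint.infty (-1) := by
  -- near infinity, `z - u = w⁻¹ (1 - u w)`
  have h1 : HolAt (fun y => 1 - u * wCoord y) OnePoint.infty :=
    ContMDiffAt.sub contMDiffAt_const (HolAt.mul contMDiffAt_const holAt_wCoord_infty)
  have h2 := hasOrd_wCoord_infty.inv.mul (h1.hasOrd_zero (by simp [wCoord]))
  refine h2.congr ?_
  filter_upwards [self_mem_nhdsWithin, eventually_ne_infty_coe 0] with y hy hy0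
  have := zCoord_ne_zero hy0 hy
  rw [wCoord_eq_inv_zCoord, inv_inv]
  field_simp

/-- A meromorphic function without zeros and poles in the affine line does not vanish at infinity: it
would be, up to removable singularities, an entire function that tends to `0`, hence zero. -/
theorem ord_infty_nonpos {F : CP1 → ℂ} (h0 : ∀ z : ℂ, HasOrd F (z : CP1) 0) {N : ℤ}
    (hN : HasOrd F OnePoint.infty N) : N ≤ 0 := by
  by_contra! hpos
  set G : ℂ → ℂ := fun z => F (z : CP1) with hG
  have hG0 : ∀ z : ℂ, MeromorphicAt G z ∧ meromorphicOrderAt G z = 0 := by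
    intro z
    have := h0 z
    unfold HasOrd at this
    rw [chartAt_coe] at this
    exact this
  have hGm : MeromorphicOn G Set.univ := fun z _ => (hG0 z).1
  set H := toMeromorphicNFOn G Set.univ with hH
  have hnf := meromorphicNFOn_toMeromorphicNFOn G Set.univ
  have hGH : ∀ z : ℂ, G =ᶠ[𝓝[≠] z] H := fun z =>
    (MeromorphicOn.toMeromorphicNFOn_eq_self_on_nhdsNE hGm (Set.mem_univ z)).symm
  have hord : ∀ z, meromorphicOrderAt H z = 0 := fun z =>
    (meromorphicOrderAt_congr (hGH z)).symm.trans (hG0 z).2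
  have han : ∀ z, AnalyticAt ℂ H z := fun z =>
    (hnf (Set.mem_univ z)).meromorphicOrderAt_nonneg_iff_analyticAt.1 (hord z).ge
  have hne : ∀ z, H z ≠ 0 := fun z =>
    (hnf (Set.mem_univ z)).meromorphicOrderAt_eq_zero_iff.1 (hord z)
  -- `F` tends to `0` at infinity, hence so does `H`
  have hF : Tendsto F (𝓝[≠] OnePoint.infty) (𝓝 0) := by
    obtain ⟨u, hu, -, h⟩ := hasOrd_iff.1 hN
    obtain ⟨m, rfl⟩ := Int.eq_ofNat_of_zero_le hpos.le
    have hc : ContinuousAt (fun y => localCoord OnePoint.infty y ^ m * u y) OnePoint.infty :=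
      (((holAt_chart_sub (chartAt_mem_maximalAtlas _) (mem_chart_source ℂ _) _).continuousAt).pow
        m).mul hu.continuousAt
    have h1 := hc.tendsto.mono_left (nhdsWithin_le_nhds (s := {OnePoint.infty}ᶜ))
    have hm : m ≠ 0 := by rintro rfl; simp at hpos
    have h2 : localCoord OnePoint.infty (OnePoint.infty : CP1) = 0 := sub_self _
    rw [h2, zero_pow hm, zero_mul] at h1
    refine h1.congr' ?_
    filter_upwards [h] with y hy
    rw [hy]
    simp
  have hHlim : Tendsto H (cocompact ℂ) (𝓝 0) := by
    rw [Metric.nhds_basis_closedBall.tendsto_right_iff]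
    intro ε hε
    have h1 : ∀ᶠ y in 𝓝[≠] (OnePoint.infty : CP1), F y ∈ Metric.closedBall 0 ε :=
      hF (Metric.closedBall_mem_nhds 0 hε)
    have h2 : ∀ᶠ z in cocompact ℂ, G z ∈ Metric.closedBall 0 ε := by
      rw [← coclosedCompact_eq_cocompact]
      have h3 : Tendsto (fun z : ℂ => (z : CP1)) (coclosedCompact ℂ) (𝓝[≠] OnePoint.infty) :=
        tendsto_nhdsWithin_iff.2 ⟨OnePoint.tendsto_coe_infty,
          Eventually.of_forall fun z => OnePoint.coe_ne_infty z⟩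
      exact h3.eventually h1
    rw [← Metric.cobounded_eq_cocompact, (Metric.hasBasis_cobounded_compl_closedBall 0).eventually_iff]
      at h2 ⊢
    obtain ⟨r, -, hr⟩ := h2
    refine ⟨r, trivial, fun z hz => ?_⟩
    have hopen : IsOpen (Metric.closedBall (0 : ℂ) r)ᶜ := Metric.isClosed_closedBall.isOpen_compl
    refine Metric.isClosed_closedBall.mem_of_tendsto
      ((han z).continuousAt.tendsto.mono_left (nhdsWithin_le_nhds (s := {z}ᶜ))) ?_
    filter_upwards [hGH z, mem_nhdsWithin_of_mem_nhds (hopen.mem_nhds hz)] with y hy hyr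
    rw [← hy]
    exact hr hyr
  have hd : Differentiable ℂ H := fun z => (han z).differentiableAt
  exact hne 0 (hd.apply_eq_of_tendsto_cocompact 0 hHlim)

theorem ord_infty_eq_zero {F : CP1 → ℂ} (h0 : ∀ z : ℂ, HasOrd F (z : CP1) 0) {N : ℤ}
    (hN : HasOrd F OnePoint.infty N) : N = 0 := by
  refine le_antisymm (ord_infty_nonpos h0 hN) ?_
  have := ord_infty_nonpos (F := fun y => (F y)⁻¹) (fun z => by simpa using (h0 z).inv) hN.inv
  omega

theorem HasOrd.finite_support {g : CP1 → ℂ} {D : CP1 → ℤ} (h : ∀ x, HasOrd g x (D x)) :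
    (Function.support D).Finite := by
  refine finite_of_forall_eventually fun x => ?_
  filter_upwards [(h x).eventually] with y hy
  simp [(h y).unique (hy.1.hasOrd_zero hy.2)]

/-- The divisor of a meromorphic function on the sphere has degree `0`. -/
theorem HasOrd.finsum_eq_zero {g : CP1 → ℂ} {D : CP1 → ℤ} (h : ∀ x, HasOrd g x (D x)) :
    ∑ᶠ x, D x = 0 := by
  classical
  have hfin := HasOrd.finite_support h
  -- the finite zeros and poles, as complex numbers
  have hfin' : {z : ℂ | D z ≠ 0}.Finite := hfin.preimage (OnePoint.coe_injective.injOn)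
  set S := hfin'.toFinset with hS
  have hmem : ∀ z : ℂ, z ∈ S ↔ D z ≠ 0 := fun z => by simp [hS]
  have hsum : ∑ᶠ x, D x = D OnePoint.infty + ∑ u ∈ S, D u := by
    have h1 : Function.support D ⊆
        (insert OnePoint.infty (S.image fun z : ℂ => (z : CP1)) : Finset CP1) := by
      intro x hx
      induction x using OnePoint.rec with
      | infty => simp
      | coe z =>
        have : z ∈ S := (hmem z).2 hx
        simp [this]
    rw [finsum_eq_sum_of_support_subset D h1, Finset.sum_insert (by simp),
      Finset.sum_image (fun a _ b _ hab => OnePoint.coe_injective hab)]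
  rw [hsum]
  -- dividing by the finite zeros and poles moves the whole divisor to infinity
  refine ord_infty_eq_zero (F := fun y => g y * ∏ u ∈ S, (zCoord y - u) ^ (-D u)) ?_ ?_
  · intro z
    have h1 := (h z).mul (HasOrd.prod (s := S) fun u _ => (hasOrd_zCoord_sub_coe u z).zpow (-D u))
    convert! h1 using 1
    simp only [mul_ite, mul_one, mul_zero, Finset.sum_ite_eq', hmem]
    by_cases hz : D z = 0 <;> simp [hz]
  · have h1 := (h OnePoint.infty).mul
      (HasOrd.prod (s := S) fun u _ => (hasOrd_zCoord_sub_infty u).zpow (-D u))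
    convert! h1 using 1
    simp

variable {r s : ℕ}

/-! ### Holomorphic sections and frames in local coordinates -/

/-- The section `t` of `E` is holomorphic near `x`. -/
def SecAt (E : HolBundle r) (t : ∀ y, E.Fiber y) (x : CP1) : Prop :=
  ContMDiffAt 𝓘(ℂ) (𝓘(ℂ).prod 𝓘(ℂ, E.Model)) ω
    (fun y => (⟨y, t y⟩ : TotalSpace E.Model E.Fiber)) x

/-- A basis of the model fiber. -/
def HolBundle.modelBasis (E : HolBundle r) : Basis (Fin r) ℂ E.Model :=
  finBasisOfFinrankEq ℂ E.Model E.finrank_model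

/-- The open set on which the preferred trivialization at `x` is defined. -/
def HolBundle.base (E : HolBundle r) (x : CP1) : Set CP1 :=
  (trivializationAt E.Model E.Fiber x).baseSet

theorem HolBundle.mem_base (E : HolBundle r) (x : CP1) : x ∈ E.base x :=
  FiberBundle.mem_baseSet_trivializationAt' x

theorem HolBundle.isOpen_base (E : HolBundle r) (x : CP1) : IsOpen (E.base x) :=
  (trivializationAt E.Model E.Fiber x).open_baseSet

theorem HolBundle.base_mem_nhds (E : HolBundle r) (x : CP1) : E.base x ∈ 𝓝 x :=
  (E.isOpen_base x).mem_nhds (E.mem_base x)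

/-- The coordinates in `ℂ ^ r` of the vectors of the fiber over `y`, in the preferred trivialization
at `x`. (They are `0` if `y` is not in `E.base x`.) -/
def HolBundle.coord (E : HolBundle r) (x y : CP1) : E.Fiber y →ₗ[ℂ] (Fin r → ℂ) :=
  E.modelBasis.equivFun.toLinearMap ∘ₗ (trivializationAt E.Model E.Fiber x).linearMapAt ℂ y

theorem HolBundle.coord_apply (E : HolBundle r) {x y : CP1} (hy : y ∈ E.base x) (v : E.Fiber y) :
    E.coord x y v = E.modelBasis.equivFun ((trivializationAt E.Model E.Fiber x) ⟨y, v⟩).2 := by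
  have := (trivializationAt E.Model E.Fiber x).coe_linearMapAt_of_mem (R := ℂ) hy
  rw [HolBundle.coord, LinearMap.comp_apply, this]
  rfl

theorem HolBundle.coord_bijective (E : HolBundle r) {x y : CP1} (hy : y ∈ E.base x) :
    Function.Bijective (E.coord x y) := by
  have h1 : ((trivializationAt E.Model E.Fiber x).linearMapAt ℂ y : E.Fiber y → E.Model) =
      (trivializationAt E.Model E.Fiber x).linearEquivAt ℂ y hy := by
    ext v
    rw [(trivializationAt E.Model E.Fiber x).coe_linearMapAt_of_mem (R := ℂ) hy]
    rfl
  rw [HolBundle.coord, LinearMap.coe_comp, h1]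
  exact E.modelBasis.equivFun.bijective.comp (LinearEquiv.bijective _)

/-- The coordinates in the preferred trivialization at `x`, as an isomorphism. -/
def HolBundle.coordEquiv (E : HolBundle r) {x y : CP1} (hy : y ∈ E.base x) :
    E.Fiber y ≃ₗ[ℂ] (Fin r → ℂ) :=
  LinearEquiv.ofBijective (E.coord x y) (E.coord_bijective hy)

instance (E : HolBundle r) (y : CP1) : FiniteDimensional ℂ (E.Fiber y) :=
  Module.Finite.equiv (E.coordEquiv (E.mem_base y)).symm

theorem contMDiffAt_model_iff (E : HolBundle r) {H M : Type*} [TopologicalSpace H] {V : Type*}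
    [NormedAddCommGroup V] [NormedSpace ℂ V] {I : ModelWithCorners ℂ V H} [TopologicalSpace M]
    [ChartedSpace H M] {g : M → E.Model} {x : M} :
    ContMDiffAt I 𝓘(ℂ, E.Model) ω g x ↔
      ∀ i, ContMDiffAt I 𝓘(ℂ) ω (fun y => E.modelBasis.equivFun (g y) i) x := by
  let T : E.Model ≃L[ℂ] (Fin r → ℂ) := E.modelBasis.equivFun.toContinuousLinearEquiv
  have h1 : ContMDiffAt I 𝓘(ℂ, E.Model) ω g x ↔
      ContMDiffAt I 𝓘(ℂ, Fin r → ℂ) ω (fun y => T (g y)) x := by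
    constructor
    · intro h
      exact ContMDiffAt.comp (g := T) x T.contDiff.contMDiff.contMDiffAt h
    · intro h
      have := ContMDiffAt.comp (g := T.symm) x T.symm.contDiff.contMDiff.contMDiffAt h
      refine this.congr_of_eventuallyEq (Eventually.of_forall fun y => ?_)
      simp
  rw [h1, contMDiffAt_pi_space]
  rfl

theorem secAt_iff_of_mem {E : HolBundle r} {t : ∀ y, E.Fiber y} {x x₀ : CP1} (hx : x ∈ E.base x₀) :
    SecAt E t x ↔ ∀ i, HolAt (fun y => E.coord x₀ y (t y) i) x := by
  rw [SecAt]
  have h1 := (trivializationAt E.Model E.Fiber x₀).contMDiffAt_section_iff (IB := 𝓘(ℂ)) (n := ω)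
    (s := t) hx
  refine h1.trans ((contMDiffAt_model_iff E).trans (forall_congr' fun i => ?_))
  refine EventuallyEq.contMDiffAt_iff ?_
  filter_upwards [(E.isOpen_base x₀).mem_nhds hx] with y hy
  rw [E.coord_apply hy]

theorem secAt_iff {E : HolBundle r} {t : ∀ y, E.Fiber y} {x : CP1} :
    SecAt E t x ↔ ∀ i, HolAt (fun y => E.coord x y (t y) i) x :=
  secAt_iff_of_mem (E.mem_base x)

theorem SecAt.congr {E : HolBundle r} {t t' : ∀ y, E.Fiber y} {x : CP1} (h : SecAt E t x)
    (h' : ∀ᶠ y in 𝓝 x, t' y = t y) : SecAt E t' x :=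
  ContMDiffAt.congr_of_eventuallyEq h (h'.mono fun y hy => by simp [hy])

theorem SecAt.eventually {E : HolBundle r} {t : ∀ y, E.Fiber y} {x : CP1} (h : SecAt E t x) :
    ∀ᶠ y in 𝓝 x, SecAt E t y := by
  have h1 : ∀ᶠ y in 𝓝 x, ∀ i, HolAt (fun w => E.coord x w (t w) i) y :=
    eventually_all.2 fun i => (secAt_iff.1 h i).eventually
  filter_upwards [h1, E.base_mem_nhds x] with y hy hyb
  exact (secAt_iff_of_mem hyb).2 hy

theorem HolAt.sum {ι : Type*} {S : Finset ι} {f : ι → CP1 → ℂ} {x : CP1}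
    (h : ∀ i ∈ S, HolAt (f i) x) : HolAt (fun y => ∑ i ∈ S, f i y) x :=
  ContMDiffAt.sum h

theorem HolAt.prod {ι : Type*} {S : Finset ι} {f : ι → CP1 → ℂ} {x : CP1}
    (h : ∀ i ∈ S, HolAt (f i) x) : HolAt (fun y => ∏ i ∈ S, f i y) x := by
  classical
  induction S using Finset.induction_on with
  | empty => simpa using contMDiffAt_const
  | insert a S ha ih =>
    simp only [Finset.prod_insert ha]
    exact (h a (by simp)).mul (ih fun i hi => h i (by simp [hi]))

theorem HolAt.det {n : ℕ} {A : CP1 → Matrix (Fin n) (Fin n) ℂ} {x : CP1}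
    (h : ∀ i j, HolAt (fun y => A y i j) x) : HolAt (fun y => (A y).det) x := by
  simp only [Matrix.det_apply']
  exact HolAt.sum fun σ _ => HolAt.mul contMDiffAt_const (HolAt.prod fun i _ => h _ _)

theorem SecAt.sum_smul {ι : Type*} {S : Finset ι} {E : HolBundle r} {c : ι → CP1 → ℂ}
    {t : ι → ∀ y, E.Fiber y} {x : CP1} (hc : ∀ i ∈ S, HolAt (c i) x)
    (ht : ∀ i ∈ S, SecAt E (t i) x) : SecAt E (fun y => ∑ i ∈ S, c i y • t i y) x := by
  rw [secAt_iff]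
  intro k
  simp only [map_sum, map_smul, Finset.sum_apply, Pi.smul_apply, smul_eq_mul]
  exact HolAt.sum fun i hi => (hc i hi).mul (secAt_iff.1 (ht i hi) k)

theorem SecAt.smul {E : HolBundle r} {c : CP1 → ℂ} {t : ∀ y, E.Fiber y} {x : CP1} (hc : HolAt c x)
    (ht : SecAt E t x) : SecAt E (fun y => c y • t y) x := by
  simpa using SecAt.sum_smul (S := {()}) (c := fun _ => c) (t := fun _ => t) (by simpa using hc)
    (by simpa using ht)

/-- The sections `f i` are a holomorphic frame near `x`. -/
def FrameAt (E : HolBundle r) (f : Fin r → ∀ y, E.Fiber y) (x : CP1) : Prop :=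
  (∀ i, SecAt E (f i) x) ∧ LinearIndependent ℂ fun i => f i x

/-- The matrix of a family of sections, in the preferred trivialization at `x`. -/
def HolBundle.coordMatrix (E : HolBundle r) (x : CP1) (f : Fin r → ∀ y, E.Fiber y) (y : CP1) :
    Matrix (Fin r) (Fin r) ℂ := Matrix.of fun i j => E.coord x y (f j y) i

theorem HolBundle.det_coordMatrix_ne_zero_iff (E : HolBundle r) {x y : CP1} (hy : y ∈ E.base x)
    (f : Fin r → ∀ y, E.Fiber y) :
    (E.coordMatrix x f y).det ≠ 0 ↔ LinearIndependent ℂ fun i => f i y := by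
  rw [← isUnit_iff_ne_zero, ← Matrix.isUnit_iff_isUnit_det,
    ← Matrix.linearIndependent_cols_iff_isUnit]
  have h1 : (E.coordMatrix x f y).col = (E.coord x y) ∘ fun i => f i y := by
    ext j i
    rfl
  rw [h1]
  exact (E.coord x y).linearIndependent_iff (LinearMap.ker_eq_bot.2 (E.coord_bijective hy).1)

theorem holAt_coordMatrix {E : HolBundle r} {x : CP1} {f : Fin r → ∀ y, E.Fiber y}
    (h : ∀ i, SecAt E (f i) x) (i j : Fin r) : HolAt (fun y => E.coordMatrix x f y i j) x :=
  secAt_iff.1 (h j) i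

theorem FrameAt.det_ne_zero {E : HolBundle r} {f : Fin r → ∀ y, E.Fiber y} {x : CP1}
    (h : FrameAt E f x) : (E.coordMatrix x f x).det ≠ 0 :=
  (E.det_coordMatrix_ne_zero_iff (E.mem_base x) f).2 h.2

theorem FrameAt.eventually {E : HolBundle r} {f : Fin r → ∀ y, E.Fiber y} {x : CP1}
    (h : FrameAt E f x) : ∀ᶠ y in 𝓝 x, FrameAt E f y := by
  filter_upwards [eventually_all.2 fun i => (h.1 i).eventually, E.base_mem_nhds x,
    (HolAt.det (holAt_coordMatrix h.1)).eventually_ne h.det_ne_zero] with y h1 h2 h3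
  exact ⟨h1, (E.det_coordMatrix_ne_zero_iff h2 f).1 h3⟩

theorem HolBundle.IsFrame.frameAt {E : HolBundle r} {f : Fin r → ∀ y, E.Fiber y} {U : Set CP1}
    (h : E.IsFrame f U) (hU : IsOpen U) {x : CP1} (hx : x ∈ U) : FrameAt E f x :=
  ⟨fun i => (h.contMDiffOn i).contMDiffAt (hU.mem_nhds hx), h.linearIndependent hx⟩

theorem span_eq_top_of_linearIndependent (E : HolBundle r) {y : CP1} {v : Fin r → E.Fiber y}
    (h : LinearIndependent ℂ v) : Submodule.span ℂ (Set.range v) = ⊤ :=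
  h.span_eq_top_of_card_eq_finrank' (by simp [E.finrank_fiber])

theorem FrameAt.exists_isFrame {E : HolBundle r} {f : Fin r → ∀ y, E.Fiber y} {x : CP1}
    (h : FrameAt E f x) : ∃ U : Set CP1, IsOpen U ∧ x ∈ U ∧ E.IsFrame f U := by
  obtain ⟨U, hU, hUo, hx⟩ := eventually_nhds_iff.1 h.eventually
  refine ⟨U, hUo, hx, ⟨fun {y} hy => (hU y hy).2,
    fun {y} hy => (span_eq_top_of_linearIndependent E (hU y hy).2).ge,
    fun i y hy => ContMDiffAt.contMDiffWithinAt ((hU y hy).1 i)⟩⟩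

/-- Every bundle has a holomorphic frame near every point. -/
theorem exists_frameAt (E : HolBundle r) (x : CP1) : ∃ f, FrameAt E f x := by
  let T := trivializationAt E.Model E.Fiber x
  have h : E.IsFrame (T.localFrame E.modelBasis) T.baseSet :=
    T.isLocalFrameOn_localFrame_baseSet 𝓘(ℂ) ω E.modelBasis
  exact ⟨_, h.frameAt T.open_baseSet (E.mem_base x)⟩

/-- The coefficients of a holomorphic section in a holomorphic frame are holomorphic. -/
theorem FrameAt.exists_coeff {E : HolBundle r} {f : Fin r → ∀ y, E.Fiber y} {x : CP1}
    (h : FrameAt E f x) {t : ∀ y, E.Fiber y} (ht : SecAt E t x) :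
    ∃ c : Fin r → CP1 → ℂ, (∀ i, HolAt (c i) x) ∧ ∀ᶠ y in 𝓝 x, t y = ∑ i, c i y • f i y := by
  -- the coefficients are given by Cramer's rule
  refine ⟨fun i y => ((E.coordMatrix x f y).det)⁻¹ *
    (E.coordMatrix x f y).cramer (E.coord x y (t y)) i, fun i => ?_, ?_⟩
  · refine ((HolAt.det (holAt_coordMatrix h.1)).inv h.det_ne_zero).mul ?_
    simp only [Matrix.cramer_apply]
    refine HolAt.det fun k l => ?_
    simp only [Matrix.updateCol_apply]
    by_cases hl : l = i
    · simpa [hl] using secAt_iff.1 ht k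
    · simpa [hl] using holAt_coordMatrix h.1 k l
  · filter_upwards [E.base_mem_nhds x,
      (HolAt.det (holAt_coordMatrix h.1)).eventually_ne h.det_ne_zero] with y hy hd
    apply (E.coord_bijective hy).1
    have h1 := Matrix.mulVec_cramer (E.coordMatrix x f y) (E.coord x y (t y))
    have h2 : E.coord x y (t y) = ((E.coordMatrix x f y).det)⁻¹ •
        (E.coordMatrix x f y).mulVec ((E.coordMatrix x f y).cramer (E.coord x y (t y))) := by
      rw [h1, smul_smul, inv_mul_cancel₀ hd, one_smul]
    conv_lhs => rw [h2]
    ext k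
    simp only [map_sum, map_smul, Finset.sum_apply, Pi.smul_apply, smul_eq_mul, Matrix.mulVec,
      dotProduct, Finset.mul_sum, HolBundle.coordMatrix, Matrix.of_apply]
    exact Finset.sum_congr rfl fun i _ => by ring

theorem FrameAt.exists_fiber_coeff {E : HolBundle r} {f : Fin r → ∀ y, E.Fiber y} {x : CP1}
    (h : FrameAt E f x) (v : E.Fiber x) : ∃ c : Fin r → ℂ, v = ∑ i, c i • f i x := by
  have h1 : v ∈ Submodule.span ℂ (Set.range fun i => f i x) := by
    rw [span_eq_top_of_linearIndependent E h.2]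
    trivial
  obtain ⟨c, hc⟩ := (Submodule.mem_span_range_iff_exists_fun ℂ).1 h1
  exact ⟨c, hc.symm⟩

/-- Two holomorphic sections that agree on a punctured neighborhood agree at the point. -/
theorem SecAt.eq_of_eventually {E : HolBundle r} {t t' : ∀ y, E.Fiber y} {x : CP1} (h : SecAt E t x)
    (h' : SecAt E t' x) (heq : ∀ᶠ y in 𝓝[≠] x, t y = t' y) : t x = t' x := by
  apply (E.coord_bijective (E.mem_base x)).1
  ext i
  refine tendsto_nhds_unique_of_eventuallyEq (l := 𝓝[≠] x)
    ((secAt_iff.1 h i).continuousAt.tendsto.mono_left nhdsWithin_le_nhds)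
    ((secAt_iff.1 h' i).continuousAt.tendsto.mono_left nhdsWithin_le_nhds) ?_
  filter_upwards [heq] with y hy
  rw [hy]

/-! ### Bundle maps -/

theorem HolHom.secAt {E : HolBundle r} {E' : HolBundle s} (φ : HolHom E E') {t : ∀ y, E.Fiber y}
    {x : CP1} (h : SecAt E t x) : SecAt E' (fun y => φ.onFiber y (t y)) x :=
  ContMDiffAt.comp (g := fun v : TotalSpace E.Model E.Fiber =>
    (⟨v.proj, φ.onFiber v.proj v.snd⟩ : TotalSpace E'.Model E'.Fiber)) x
    φ.holomorphic.contMDiffAt h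

/-- A fiberwise linear map is holomorphic if near every point it maps some holomorphic frame to
holomorphic sections. -/
theorem contMDiff_of_frames {E : HolBundle r} {E' : HolBundle s}
    (ψ : ∀ x, E.Fiber x →ₗ[ℂ] E'.Fiber x)
    (h : ∀ x, ∃ f, FrameAt E f x ∧ ∀ j, SecAt E' (fun y => ψ y (f j y)) x) :
    ContMDiff (𝓘(ℂ).prod 𝓘(ℂ, E.Model)) (𝓘(ℂ).prod 𝓘(ℂ, E'.Model)) ω
      (fun v : TotalSpace E.Model E.Fiber =>
        (⟨v.proj, ψ v.proj v.snd⟩ : TotalSpace E'.Model E'.Fiber)) := by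
  intro v₀
  set x := v₀.proj with hx
  obtain ⟨f, hf, hψf⟩ := h x
  -- the frame given by the preferred trivialization is mapped to holomorphic sections
  obtain ⟨e, hec⟩ : ∃ e : Fin r → ∀ y, E.Fiber y, ∀ y ∈ E.base x, ∀ j,
      E.coord x y (e j y) = Pi.single j 1 := by
    classical
    refine ⟨fun j y => if hy : y ∈ E.base x then (E.coordEquiv hy).symm (Pi.single j 1) else 0,
      fun y hy j => ?_⟩
    simp only [hy, dite_true]
    exact (E.coordEquiv hy).apply_symm_apply _
  have he : ∀ j, SecAt E (e j) x := by
    intro j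
    rw [secAt_iff]
    intro i
    refine ContMDiffAt.congr_of_eventuallyEq (f := fun _ => (Pi.single j 1 : Fin r → ℂ) i)
      contMDiffAt_const ?_
    filter_upwards [E.base_mem_nhds x] with y hy
    rw [hec y hy]
  have hψe : ∀ j, SecAt E' (fun y => ψ y (e j y)) x := by
    intro j
    obtain ⟨c, hc, hce⟩ := hf.exists_coeff (he j)
    refine (SecAt.sum_smul (S := Finset.univ) (fun i _ => hc i) fun i _ => hψf i).congr ?_
    filter_upwards [hce] with y hy
    rw [hy]
    simp
  have hproj : ContMDiffAt (𝓘(ℂ).prod 𝓘(ℂ, E.Model)) 𝓘(ℂ) ω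
      (fun v : TotalSpace E.Model E.Fiber => v.proj) v₀ := contMDiffAt_proj E.Fiber
  refine contMDiffAt_totalSpace.2 ⟨hproj, (contMDiffAt_model_iff E').2 fun k => ?_⟩
  -- the coordinates of a vector are holomorphic on the total space
  have hcoord : ∀ j, ContMDiffAt (𝓘(ℂ).prod 𝓘(ℂ, E.Model)) 𝓘(ℂ) ω
      (fun v : TotalSpace E.Model E.Fiber =>
        E.modelBasis.equivFun ((trivializationAt E.Model E.Fiber x) v).2 j) v₀ :=
    (contMDiffAt_model_iff E).1 (contMDiffAt_totalSpace.1 contMDiffAt_id).2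
  have himg : ∀ j, ContMDiffAt (𝓘(ℂ).prod 𝓘(ℂ, E.Model)) 𝓘(ℂ) ω
      (fun v : TotalSpace E.Model E.Fiber => E'.coord x v.proj (ψ v.proj (e j v.proj)) k) v₀ :=
    fun j => ContMDiffAt.comp (g := fun y => E'.coord x y (ψ y (e j y)) k) v₀
      (secAt_iff.1 (hψe j) k) hproj
  have hsum : ContMDiffAt (𝓘(ℂ).prod 𝓘(ℂ, E.Model)) 𝓘(ℂ) ω
      (fun v : TotalSpace E.Model E.Fiber => ∑ j,
        E.modelBasis.equivFun ((trivializationAt E.Model E.Fiber x) v).2 j *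
          E'.coord x v.proj (ψ v.proj (e j v.proj)) k) v₀ :=
    ContMDiffAt.sum fun j _ => ContMDiffAt.smul (hcoord j) (himg j)
  refine hsum.congr_of_eventuallyEq ?_
  have h1 : ∀ᶠ v : TotalSpace E.Model E.Fiber in 𝓝 v₀, v.proj ∈ E.base x ∩ E'.base x :=
    hproj.continuousAt.eventually (inter_mem (E.base_mem_nhds x) (E'.base_mem_nhds x))
  filter_upwards [h1] with v hv
  obtain ⟨y, w⟩ := v
  obtain ⟨hy, hy'⟩ := hv
  have h2 : w = ∑ j, E.coord x y w j • e j y := by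
    apply (E.coord_bijective hy).1
    simp only [map_sum, map_smul, hec y hy]
    ext i
    simp [Finset.sum_apply, Pi.single_apply]
  have h3 := E'.coord_apply hy' (ψ y w)
  change E'.modelBasis.equivFun ((trivializationAt E'.Model E'.Fiber x) ⟨y, ψ y w⟩).2 k = _
  rw [← h3]
  conv_lhs => rw [h2]
  simp only [map_sum, map_smul, Finset.sum_apply, Pi.smul_apply, smul_eq_mul, E.coord_apply hy]

/-- The bundle map given by a fiberwise linear map that near every point maps some holomorphic frame
to holomorphic sections. -/
def HolHom.ofFrames {E : HolBundle r} {E' : HolBundle s} (ψ : ∀ x, E.Fiber x →ₗ[ℂ] E'.Fiber x)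
    (h : ∀ x, ∃ f, FrameAt E f x ∧ ∀ j, SecAt E' (fun y => ψ y (f j y)) x) : HolHom E E' where
  onFiber := ψ
  holomorphic := contMDiff_of_frames ψ h

/-- The composition of bundle maps. -/
def HolHom.comp {k : ℕ} {E : HolBundle r} {E' : HolBundle s} {E'' : HolBundle k} (ψ : HolHom E' E'')
    (φ : HolHom E E') : HolHom E E'' where
  onFiber := fun x => ψ.onFiber x ∘ₗ φ.onFiber x
  holomorphic := ψ.holomorphic.comp φ.holomorphic

/-- The identity map of a bundle. -/
def HolHom.id (E : HolBundle r) : HolHom E E where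
  onFiber := fun _ => LinearMap.id
  holomorphic := contMDiff_id

/-- The identity isomorphism. -/
def HolIso.refl (E : HolBundle r) : HolIso E E :=
  ⟨HolHom.id E, HolHom.id E, fun _ _ => rfl, fun _ _ => rfl⟩

/-- The inverse isomorphism. -/
def HolIso.symm {E : HolBundle r} {E' : HolBundle s} (φ : HolIso E E') : HolIso E' E :=
  ⟨φ.inv, φ.hom, φ.hom_inv, φ.inv_hom⟩

/-- The composition of isomorphisms. -/
def HolIso.trans {k : ℕ} {E : HolBundle r} {E' : HolBundle s} {E'' : HolBundle k} (φ : HolIso E E')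
    (ψ : HolIso E' E'') : HolIso E E'' where
  hom := ψ.hom.comp φ.hom
  inv := φ.inv.comp ψ.inv
  inv_hom := fun x v => by simp [HolHom.comp, ψ.inv_hom, φ.inv_hom]
  hom_inv := fun x v => by simp [HolHom.comp, ψ.hom_inv, φ.hom_inv]

theorem HolIso.bijective {E : HolBundle r} {E' : HolBundle s} (φ : HolIso E E') (x : CP1) :
    Function.Bijective (φ.hom.onFiber x) :=
  ⟨Function.LeftInverse.injective (φ.inv_hom x), Function.RightInverse.surjective (φ.hom_inv x)⟩

theorem FrameAt.map {E E' : HolBundle r} (φ : HolHom E E') {f : Fin r → ∀ y, E.Fiber y} {x : CP1}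
    (h : FrameAt E f x) (hφ : Function.Injective (φ.onFiber x)) :
    FrameAt E' (fun i y => φ.onFiber y (f i y)) x :=
  ⟨fun i => φ.secAt (h.1 i), h.2.map' _ (LinearMap.ker_eq_bot.2 hφ)⟩

/-! ### The degree of a bundle -/

/-- An alternating map in top degree is determined by its value on a basis. -/
theorem alternatingMap_eq_det_smul {V N : Type*} [AddCommGroup V] [Module ℂ V] [AddCommGroup N]
    [Module ℂ N] (b : Basis (Fin r) ℂ V) (g : V [⋀^Fin r]→ₗ[ℂ] N) (v : Fin r → V) :
    g v = b.det v • g b := by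
  have h : g = (LinearMap.toSpanSingleton ℂ N (g b)).compAlternatingMap b.det := by
    refine b.ext_alternating fun σ hσ => ?_
    obtain ⟨τ, rfl⟩ : ∃ τ : Equiv.Perm (Fin r), σ = τ :=
      ⟨Equiv.ofBijective σ (Finite.injective_iff_bijective.1 hσ), rfl⟩
    have h1 : (fun i => b (τ i)) = b ∘ τ := rfl
    simp only [LinearMap.compAlternatingMap_apply, LinearMap.toSpanSingleton_apply, h1,
      AlternatingMap.map_perm, b.det_self]
    simp
  conv_lhs => rw [h]
  simp

/-- The basis of the fiber over `y` given by the preferred trivialization at `x`. -/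
def HolBundle.fiberBasis (E : HolBundle r) {x y : CP1} (hy : y ∈ E.base x) :
    Basis (Fin r) ℂ (E.Fiber y) := Basis.ofEquivFun (E.coordEquiv hy)

theorem HolBundle.fiberBasis_det (E : HolBundle r) {x y : CP1} (hy : y ∈ E.base x)
    (f : Fin r → ∀ y, E.Fiber y) :
    (E.fiberBasis hy).det (fun i => f i y) = (E.coordMatrix x f y).det := by
  rw [Basis.det_apply]
  rfl

/-- The determinant, as a linear function on the top exterior power of the fiber over `y`. -/
def HolBundle.detFun (E : HolBundle r) (y : CP1) : ⋀[ℂ]^r (E.Fiber y) →ₗ[ℂ] ℂ :=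
  exteriorPower.alternatingMapLinearEquiv (E.fiberBasis (E.mem_base y)).det

theorem HolBundle.detFun_ne_zero (E : HolBundle r) {y : CP1} {f : Fin r → ∀ y, E.Fiber y}
    (h : LinearIndependent ℂ fun i => f i y) :
    E.detFun y (exteriorPower.ιMulti ℂ r fun i => f i y) ≠ 0 := by
  rw [HolBundle.detFun, exteriorPower.alternatingMapLinearEquiv_apply_ιMulti, E.fiberBasis_det]
  exact (E.det_coordMatrix_ne_zero_iff (E.mem_base y) f).2 h

theorem ιMulti_ne_zero (E : HolBundle r) {y : CP1} {f : Fin r → ∀ y, E.Fiber y}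
    (h : LinearIndependent ℂ fun i => f i y) :
    exteriorPower.ιMulti ℂ r (fun i => f i y) ≠ 0 := fun h0 => by
  have := E.detFun_ne_zero h
  rw [h0, map_zero] at this
  exact this rfl

/-- Two holomorphic frames differ, on the determinant bundle, by an invertible function. -/
theorem FrameAt.exists_change {E : HolBundle r} {f f' : Fin r → ∀ y, E.Fiber y} {x : CP1}
    (h : FrameAt E f x) (h' : FrameAt E f' x) :
    ∃ δ : CP1 → ℂ, HolAt δ x ∧ δ x ≠ 0 ∧ ∀ᶠ y in 𝓝 x,
      exteriorPower.ιMulti ℂ r (fun i => f i y) = δ y • exteriorPower.ιMulti ℂ r fun i => f' i y := by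
  refine ⟨fun y => (E.coordMatrix x f y).det * ((E.coordMatrix x f' y).det)⁻¹,
    (HolAt.det (holAt_coordMatrix h.1)).mul ((HolAt.det (holAt_coordMatrix h'.1)).inv h'.det_ne_zero),
    mul_ne_zero h.det_ne_zero (inv_ne_zero h'.det_ne_zero), ?_⟩
  filter_upwards [E.base_mem_nhds x,
    (HolAt.det (holAt_coordMatrix h'.1)).eventually_ne h'.det_ne_zero] with y hy hd
  rw [alternatingMap_eq_det_smul (E.fiberBasis hy) _ fun i => f i y,
    alternatingMap_eq_det_smul (E.fiberBasis hy) _ fun i => f' i y, E.fiberBasis_det,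
    E.fiberBasis_det, smul_smul, mul_assoc, inv_mul_cancel₀ hd, mul_one]

/-- The order of a section of the determinant bundle can be computed in any holomorphic frame. -/
theorem FrameAt.hasDetOrder_iff {E : HolBundle r} {f : Fin r → ∀ y, E.Fiber y} {x : CP1}
    (h : FrameAt E f x) {σ : ∀ x, ⋀[ℂ]^r (E.Fiber x)} {k : ℤ} :
    E.HasDetOrder σ x k ↔ ∃ g : CP1 → ℂ, HasOrd g x k ∧
      ∀ᶠ y in 𝓝[≠] x, σ y = g y • exteriorPower.ιMulti ℂ r fun i => f i y := by
  constructor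
  · rintro ⟨U, hU, hx, e, he, g, hg1, hg2, hσ⟩
    obtain ⟨δ, hδ, hδ0, hc⟩ := (he.frameAt hU hx).exists_change h
    refine ⟨fun y => g y * δ y, by simpa using HasOrd.mul ⟨hg1, hg2⟩ (hδ.hasOrd_zero hδ0), ?_⟩
    filter_upwards [mem_nhdsWithin_of_mem_nhds hc, mem_nhdsWithin_of_mem_nhds (hU.mem_nhds hx),
      self_mem_nhdsWithin] with y h1 h2 h3
    rw [hσ y h2 h3, h1, smul_smul]
  · rintro ⟨g, hg, hσ⟩
    obtain ⟨U, hU, hx, he⟩ := h.exists_isFrame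
    rw [eventually_nhdsWithin_iff] at hσ
    obtain ⟨V, hV, hVo, hxV⟩ := eventually_nhds_iff.1 hσ
    refine ⟨U ∩ V, hU.inter hVo, ⟨hx, hxV⟩, f, IsLocalFrameOn.mono he Set.inter_subset_left, g,
      hg.1, hg.2, fun y hy hyx => hV y hy.2 hyx⟩

theorem HolBundle.HasDetOrder.unique {E : HolBundle r} {σ : ∀ x, ⋀[ℂ]^r (E.Fiber x)} {x : CP1}
    {k l : ℤ} (h : E.HasDetOrder σ x k) (h' : E.HasDetOrder σ x l) : k = l := by
  obtain ⟨f, hf⟩ := exists_frameAt E x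
  obtain ⟨g, hg, h1⟩ := hf.hasDetOrder_iff.1 h
  obtain ⟨g', hg', h2⟩ := hf.hasDetOrder_iff.1 h'
  refine hg.unique (hg'.congr ?_)
  filter_upwards [h1, h2, mem_nhdsWithin_of_mem_nhds hf.eventually] with y h3 h4 h5
  rw [h3] at h4
  exact smul_left_injective ℂ (ιMulti_ne_zero E h5.2) h4

theorem HolBundle.HasDetOrder.eventually {E : HolBundle r} {σ : ∀ x, ⋀[ℂ]^r (E.Fiber x)} {x : CP1}
    {k : ℤ} (h : E.HasDetOrder σ x k) : ∀ᶠ y in 𝓝[≠] x, E.HasDetOrder σ y 0 := by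
  obtain ⟨f, hf⟩ := exists_frameAt E x
  obtain ⟨g, hg, h1⟩ := hf.hasDetOrder_iff.1 h
  filter_upwards [eventually_eventually_nhdsWithin.2 h1, hg.eventually,
    mem_nhdsWithin_of_mem_nhds hf.eventually, self_mem_nhdsWithin] with y h2 h3 h4 hyx
  rw [IsOpen.nhdsWithin_eq isOpen_compl_singleton hyx] at h2
  exact h4.hasDetOrder_iff.2 ⟨g, h3.1.hasOrd_zero h3.2, h2.filter_mono nhdsWithin_le_nhds⟩

theorem HolBundle.HasDetOrder.finite_support {E : HolBundle r} {σ : ∀ x, ⋀[ℂ]^r (E.Fiber x)}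
    {D : CP1 → ℤ} (h : ∀ x, E.HasDetOrder σ x (D x)) : (Function.support D).Finite := by
  refine finite_of_forall_eventually fun x => ?_
  filter_upwards [(h x).eventually] with y hy
  simp [(h y).unique hy]

/-- The degree does not depend on the meromorphic section: the quotient of two meromorphic sections
of the determinant bundle is a meromorphic function. -/
theorem HolBundle.HasDegree.unique {E : HolBundle r} {d d' : ℤ} (h : E.HasDegree d)
    (h' : E.HasDegree d') : d = d' := by
  obtain ⟨σ, D, hD, rfl⟩ := h
  obtain ⟨σ', D', hD', rfl⟩ := h'
  have key : ∀ x, HasOrd (fun y => E.detFun y (σ y) / E.detFun y (σ' y)) x (D x - D' x) := by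
    intro x
    obtain ⟨f, hf⟩ := exists_frameAt E x
    obtain ⟨g, hg, h1⟩ := hf.hasDetOrder_iff.1 (hD x)
    obtain ⟨g', hg', h2⟩ := hf.hasDetOrder_iff.1 (hD' x)
    refine (hg.div hg').congr ?_
    filter_upwards [h1, h2, mem_nhdsWithin_of_mem_nhds hf.eventually] with y h3 h4 h5
    rw [h3, h4, map_smul, map_smul, smul_eq_mul, smul_eq_mul,
      mul_div_mul_right _ _ (E.detFun_ne_zero h5.2)]
  have h1 := HasOrd.finsum_eq_zero key
  rw [finsum_sub_distrib (HolBundle.HasDetOrder.finite_support hD)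
    (HolBundle.HasDetOrder.finite_support hD')] at h1
  exact sub_eq_zero.1 h1

theorem HolBundle.HasDegree.deg_eq {E : HolBundle r} {d : ℤ} (h : E.HasDegree d) : E.deg = d :=
  HolBundle.HasDegree.unique (Classical.epsilon_spec ⟨d, h⟩) h

theorem HolBundle.HasTrivialDet.hasDegree {E : HolBundle r} (h : E.HasTrivialDet) :
    E.HasDegree 0 := by
  obtain ⟨σ, hσ⟩ := h
  refine ⟨σ, fun _ => 0, fun x => ?_, finsum_zero⟩
  obtain ⟨U, hU, hx, e, he, h1⟩ := hσ x
  refine (he.frameAt hU hx).hasDetOrder_iff.2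
    ⟨fun _ => 1, HolAt.hasOrd_zero contMDiffAt_const one_ne_zero, ?_⟩
  filter_upwards [mem_nhdsWithin_of_mem_nhds (hU.mem_nhds hx)] with y hy
  rw [h1 y hy, one_smul]

open Classical in
theorem finsum_ite_eq (p : CP1) : ∑ᶠ x : CP1, (if x = p then (1 : ℤ) else 0) = 1 := by
  rw [finsum_eq_single _ p fun x hx => if_neg hx, if_pos rfl]

/-- Let `α : F → E` be a meromorphic map of bundles of the same rank, given on the fibers, whose
determinant has the divisor `κ`. The sections of the determinant bundle of `E` pull back along `α`,
so that the degree of `F` is the degree of `E` minus the degree of `κ`. -/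
theorem HolBundle.HasDegree.pullback {E F : HolBundle r} (α : ∀ y, F.Fiber y →ₗ[ℂ] E.Fiber y)
    (κ : CP1 → ℤ)
    (hα : ∀ x, ∃ (f : Fin r → ∀ y, F.Fiber y) (e : Fin r → ∀ y, E.Fiber y) (h : CP1 → ℂ),
      FrameAt F f x ∧ FrameAt E e x ∧ HasOrd h x (κ x) ∧ ∀ᶠ y in 𝓝[≠] x,
        Function.Bijective (α y) ∧ exteriorPower.ιMulti ℂ r (fun i => α y (f i y)) =
          h y • exteriorPower.ιMulti ℂ r fun i => e i y) {d : ℤ} (hd : E.HasDegree d) :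
    (Function.support κ).Finite ∧ F.HasDegree (d - ∑ᶠ x, κ x) := by
  classical
  obtain ⟨σ, D, hD, rfl⟩ := hd
  have key : ∀ x, F.HasDetOrder (fun y => if hy : Function.Bijective (α y) then
      exteriorPower.map r (LinearEquiv.ofBijective (α y) hy).symm.toLinearMap (σ y) else 0)
      x (D x - κ x) := by
    intro x
    obtain ⟨f, e, h, hf, he, hh, hev⟩ := hα x
    obtain ⟨g, hg, hσ⟩ := he.hasDetOrder_iff.1 (hD x)
    refine hf.hasDetOrder_iff.2 ⟨fun y => g y / h y, hg.div hh, ?_⟩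
    filter_upwards [hev, hσ, hh.eventually] with y ⟨hb, h1⟩ h2 h3
    have h4 : (fun i => f i y) = (LinearEquiv.ofBijective (α y) hb).symm.toLinearMap ∘
        fun i => α y (f i y) := by
      ext i
      exact ((LinearEquiv.ofBijective (α y) hb).symm_apply_apply (f i y)).symm
    rw [dif_pos hb, h4, ← exteriorPower.map_apply_ιMulti, h1, h2, map_smul, map_smul,
      smul_smul, div_mul_cancel₀ _ h3.2]
  have hDfin := HolBundle.HasDetOrder.finite_support hD
  have hκ : (Function.support κ).Finite := by
    refine (hDfin.union (HolBundle.HasDetOrder.finite_support key)).subset fun x hx => ?_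
    simp only [Set.mem_union, Function.mem_support] at hx ⊢
    omega
  exact ⟨hκ, _, _, key, finsum_sub_distrib hDfin hκ⟩

theorem HolBundle.HasDegree.of_iso {E F : HolBundle r} (φ : HolIso F E) {d : ℤ}
    (hd : E.HasDegree d) : F.HasDegree d := by
  have := hd.pullback φ.hom.onFiber (fun _ => 0) fun x => by
    obtain ⟨f, hf⟩ := exists_frameAt F x
    exact ⟨f, _, fun _ => 1, hf, hf.map φ.hom (φ.bijective x).1,
      HolAt.hasOrd_zero contMDiffAt_const one_ne_zero,
      Eventually.of_forall fun y => ⟨φ.bijective y, by simp⟩⟩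
  simpa using this.2

/-- A Hecke modification lowers the degree by `1`. -/
theorem IsHecke.hasDegree {E F : HolBundle 2} {α : HolHom F E} {p : CP1} (h : IsHecke α p) {d : ℤ}
    (hd : E.HasDegree d) : F.HasDegree (d - 1) := by
  classical
  have h1 := (hd.pullback α.onFiber (fun x => if x = p then 1 else 0) fun x => by
      by_cases hx : x = p
      · subst hx
        obtain ⟨hbij, ξ, hξ, hp, e, f, he, hf, hα⟩ := h
        refine ⟨f, e, fun y => ξ y - ξ x, hf.frameAt ξ.open_source hp,
          he.frameAt ξ.open_source hp, by simpa using hasOrd_chart_sub hξ hp, ?_⟩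
        filter_upwards [self_mem_nhdsWithin, mem_nhdsWithin_of_mem_nhds (ξ.open_source.mem_nhds hp)]
          with y hy hys
        refine ⟨hbij y hy, ?_⟩
        have h2 : (fun i => α.onFiber y (f i y)) =
            Function.update (fun i => e i y) 1 ((ξ y - ξ x) • e 1 y) := by
          ext i
          fin_cases i
          · simp [(hα y hys).1]
          · simp [(hα y hys).2]
        rw [h2, AlternatingMap.map_update_smul, Function.update_eq_self]
      · obtain ⟨f, hf⟩ := exists_frameAt F x
        refine ⟨f, _, fun _ => 1, hf, hf.map α (h.1 x hx).1, by
          simpa [hx] using HolAt.hasOrd_zero contMDiffAt_const (one_ne_zero (α := ℂ)), ?_⟩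
        filter_upwards [mem_nhdsWithin_of_mem_nhds (isOpen_ne.mem_nhds hx)] with y hy
        exact ⟨h.1 y hy, by simp⟩).2
  rwa [finsum_ite_eq] at h1

/-! ### Lifting along Hecke modifications -/

/-- A holomorphic section of `E` whose value at `p` is in the image lifts to a Hecke modification of
`E` at `p`. -/
theorem IsHecke.exists_lift {E F : HolBundle 2} {α : HolHom F E} {p : CP1} (h : IsHecke α p) {x : CP1}
    {t : ∀ y, E.Fiber y} (ht : SecAt E t x) (hx : x = p → t x ∈ LinearMap.range (α.onFiber x)) :
    ∃ t', SecAt F t' x ∧ ∀ᶠ y in 𝓝 x, α.onFiber y (t' y) = t y := by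
  by_cases hxp : x = p
  · subst hxp
    obtain ⟨-, ξ, hξ, hp, e, f, he, hf, hα⟩ := h
    have he' := he.frameAt ξ.open_source hp
    have hf' := hf.frameAt ξ.open_source hp
    obtain ⟨c, hc, hce⟩ := he'.exists_coeff ht
    obtain ⟨v, hv⟩ := hx rfl
    obtain ⟨a, rfl⟩ := hf'.exists_fiber_coeff v
    -- the second coefficient vanishes at the point, so it is divisible by the coordinate
    have hc1 : c 1 x = 0 := by
      have h1 := hce.self_of_nhds
      rw [← hv, map_sum, Fin.sum_univ_two, Fin.sum_univ_two, map_smul, map_smul, (hα x hp).1,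
        (hα x hp).2, sub_self, zero_smul, smul_zero, add_zero] at h1
      have h2 := Fintype.linearIndependent_iff.1 he'.2 ![c 0 x - a 0, c 1 x] (by
        simp only [Fin.sum_univ_two, Matrix.cons_val_zero, Matrix.cons_val_one, sub_smul]
        rw [h1]
        abel) 1
      simpa using h2
    obtain ⟨u, hu, hcu⟩ := (hc 1).exists_eq_mul hξ hp hc1
    refine ⟨fun y => ∑ i, (![c 0, u] : Fin 2 → CP1 → ℂ) i y • f i y, SecAt.sum_smul ?_
      (fun i _ => hf'.1 i), ?_⟩
    · intro i _
      fin_cases i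
      · exact hc 0
      · exact hu
    · filter_upwards [hce, hcu, ξ.open_source.mem_nhds hp] with y h1 h2 h3
      rw [h1, Fin.sum_univ_two, Fin.sum_univ_two, map_add, map_smul, map_smul, (hα y h3).1,
        (hα y h3).2, h2, smul_smul]
      simp [mul_comm]
  · obtain ⟨f, hf⟩ := exists_frameAt F x
    obtain ⟨c, hc, hce⟩ := (hf.map α (h.1 x hxp).1).exists_coeff ht
    refine ⟨fun y => ∑ i, c i y • f i y, SecAt.sum_smul (fun i _ => hc i) (fun i _ => hf.1 i), ?_⟩
    filter_upwards [hce] with y hy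
    rw [hy]
    simp

/-- Bundle maps lift to Hecke modifications at the same point if they map the image to the image. -/
theorem IsHecke.exists_lift_hom {E F E' F' : HolBundle 2} {α : HolHom F E} {α' : HolHom F' E'} {p : CP1}
    (h' : IsHecke α' p) (φ : HolHom E E')
    (hφ : ∀ v, φ.onFiber p (α.onFiber p v) ∈ LinearMap.range (α'.onFiber p)) :
    ∃ ψ : HolHom F F', ∀ x v, α'.onFiber x (ψ.onFiber x v) = φ.onFiber x (α.onFiber x v) := by
  have key : ∀ x, ∃ (f : Fin 2 → ∀ y, F.Fiber y) (t : Fin 2 → ∀ y, F'.Fiber y), FrameAt F f x ∧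
      ∀ j, SecAt F' (t j) x ∧
        ∀ᶠ y in 𝓝 x, α'.onFiber y (t j y) = φ.onFiber y (α.onFiber y (f j y)) := by
    intro x
    obtain ⟨f, hf⟩ := exists_frameAt F x
    have h1 : ∀ j, ∃ t', SecAt F' t' x ∧
        ∀ᶠ y in 𝓝 x, α'.onFiber y (t' y) = φ.onFiber y (α.onFiber y (f j y)) := fun j =>
      h'.exists_lift (φ.secAt (α.secAt (hf.1 j))) fun hx => by subst hx; exact hφ _
    choose t ht using h1
    exact ⟨f, t, hf, ht⟩
  choose f t hf ht using key
  have hbasis : ∀ x, ∃ ψ : F.Fiber x →ₗ[ℂ] F'.Fiber x, ∀ j, ψ (f x j x) = t x j x := by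
    intro x
    let b := basisOfLinearIndependentOfCardEqFinrank (hf x).2 (by simp [F.finrank_fiber])
    refine ⟨b.constr ℂ fun j => t x j x, fun j => ?_⟩
    have hb : b j = f x j x := by simp [b]
    rw [← hb, b.constr_basis]
  choose ψ hψ using hbasis
  have hcomm : ∀ x v, α'.onFiber x (ψ x v) = φ.onFiber x (α.onFiber x v) := by
    intro x v
    obtain ⟨c, rfl⟩ := (hf x).exists_fiber_coeff v
    simp only [map_sum, map_smul, hψ]
    exact Finset.sum_congr rfl fun j _ => by rw [(ht x j).2.self_of_nhds]
  refine ⟨HolHom.ofFrames ψ fun x => ⟨f x, hf x, fun j => (ht x j).1.congr ?_⟩, hcomm⟩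
  have hpx : ∀ᶠ y in 𝓝 x, y = x ∨ y ≠ p := by
    by_cases hx : x = p
    · exact Eventually.of_forall fun y => by rw [hx]; exact em _
    · filter_upwards [isOpen_ne.mem_nhds hx] with y hy using Or.inr hy
  filter_upwards [hpx, (ht x j).2] with y hy h1
  rcases hy with rfl | hy
  · exact hψ y j
  · apply (h'.1 y hy).1
    rw [hcomm, h1]

/-- Two bundle maps that agree away from one point are equal. -/
theorem HolHom.eq_of_forall_ne {E : HolBundle r} {E' : HolBundle s} {φ ψ : HolHom E E'} {p : CP1}
    (h : ∀ x, x ≠ p → ∀ v, φ.onFiber x v = ψ.onFiber x v) (x : CP1) (v : E.Fiber x) :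
    φ.onFiber x v = ψ.onFiber x v := by
  by_cases hx : x = p
  · obtain ⟨f, hf⟩ := exists_frameAt E x
    obtain ⟨c, rfl⟩ := hf.exists_fiber_coeff v
    simp only [map_sum, map_smul]
    refine Finset.sum_congr rfl fun j _ => ?_
    congr 1
    refine (φ.secAt (hf.1 j)).eq_of_eventually (ψ.secAt (hf.1 j)) ?_
    filter_upwards [self_mem_nhdsWithin] with y hy
    exact h y (fun hyp => hy (hyp.trans hx.symm)) _
  · exact h x hx v

/-- Isomorphisms lift to Hecke modifications at the same point if they identify the images. -/
theorem IsHecke.exists_lift_iso {E F E' F' : HolBundle 2} {α : HolHom F E} {α' : HolHom F' E'}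
    {p : CP1} (h : IsHecke α p) (h' : IsHecke α' p) (φ : HolIso E E')
    (hφ : ∀ v, φ.hom.onFiber p (α.onFiber p v) ∈ LinearMap.range (α'.onFiber p))
    (hφ' : ∀ v, φ.inv.onFiber p (α'.onFiber p v) ∈ LinearMap.range (α.onFiber p)) :
    ∃ ψ : HolIso F F', ∀ x v,
      α'.onFiber x (ψ.hom.onFiber x v) = φ.hom.onFiber x (α.onFiber x v) := by
  obtain ⟨ψ, hψ⟩ := h'.exists_lift_hom φ.hom hφ
  obtain ⟨ψ', hψ'⟩ := h.exists_lift_hom φ.inv hφ'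
  refine ⟨⟨ψ, ψ', ?_, ?_⟩, hψ⟩
  · refine HolHom.eq_of_forall_ne (φ := ψ'.comp ψ) (ψ := HolHom.id F) (p := p) fun x hx v => ?_
    apply (h.1 x hx).1
    change α.onFiber x (ψ'.onFiber x (ψ.onFiber x v)) = α.onFiber x v
    rw [hψ', hψ, φ.inv_hom]
  · refine HolHom.eq_of_forall_ne (φ := ψ.comp ψ') (ψ := HolHom.id F') (p := p) fun x hx v => ?_
    apply (h'.1 x hx).1
    change α'.onFiber x (ψ.onFiber x (ψ'.onFiber x v)) = α'.onFiber x v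
    rw [hψ, hψ', φ.hom_inv]

/-- A sequence of Hecke modifications at distinct points is determined, up to isomorphism, by its
first bundle and its lines. -/
theorem HeckeSeq.exists_iso {n : ℕ} {p : Fin n → CP1} (hp : Function.Injective p) (S S' : HeckeSeq p)
    (φ : HolIso (S.bundle 0) (S'.bundle 0))
    (hφ : ∀ i, (S.line i).map (φ.hom.onFiber (p i)) = S'.line i) :
    ∃ Φ : ∀ i, HolIso (S.bundle i) (S'.bundle i), Φ 0 = φ ∧
      ∀ (i : Fin n) (x : CP1) (v : (S.bundle i.succ).Fiber x),
        (S'.α i).onFiber x ((Φ i.succ).hom.onFiber x v) =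
          (Φ i.castSucc).hom.onFiber x ((S.α i).onFiber x v) := by
  let T : Fin (n + 1) → Type := fun i => {ψ : HolIso (S.bundle i) (S'.bundle i) //
    ∀ x v, S'.comp i x (ψ.hom.onFiber x v) = φ.hom.onFiber x (S.comp i x v)}
  have step : ∀ (i : Fin n) (ψ : T i.castSucc), ∃ ψ' : T i.succ, ∀ x v,
      (S'.α i).onFiber x (ψ'.1.hom.onFiber x v) = ψ.1.hom.onFiber x ((S.α i).onFiber x v) := by
    rintro i ⟨ψ, hψ⟩
    have hinj : ∀ S : HeckeSeq p, Function.Injective (S.comp i.castSucc (p i)) := fun S =>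
      S.comp_injective (p i) i.castSucc fun j hj h => by
        rw [hp h] at hj
        exact lt_irrefl _ hj
    obtain ⟨ψ', hψ'⟩ := (S.isHecke i).exists_lift_iso (S'.isHecke i) ψ (fun v => by
        have h1 : φ.hom.onFiber (p i) (S.comp i.succ (p i) v) ∈ S'.line i := by
          rw [← hφ i]
          exact Submodule.mem_map_of_mem ⟨v, rfl⟩
        obtain ⟨w, hw⟩ := h1
        refine ⟨w, hinj S' ?_⟩
        rw [hψ]
        exact hw) fun v => by
        have h1 : S'.comp i.succ (p i) v ∈ (S.line i).map (φ.hom.onFiber (p i)) := by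
          rw [hφ i]
          exact ⟨v, rfl⟩
        obtain ⟨_, ⟨w, rfl⟩, hw⟩ := h1
        refine ⟨w, ?_⟩
        apply (ψ.bijective (p i)).1
        rw [ψ.hom_inv]
        apply hinj S'
        rw [hψ]
        exact hw
    refine ⟨⟨ψ', fun x v => ?_⟩, hψ'⟩
    change S'.comp i.castSucc x ((S'.α i).onFiber x (ψ'.hom.onFiber x v)) = _
    rw [hψ', hψ]
    rfl
  choose next hnext using step
  let Φ : ∀ i, T i := fun i => Fin.induction (motive := T) ⟨φ, fun _ _ => rfl⟩ next i
  exact ⟨fun i => (Φ i).1, rfl, fun i x v => hnext i (Φ i.castSucc) x v⟩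

/-- A section of `E₀` near `x` lifts to `E_i`, after multiplication by the local coordinate for each
Hecke modification at `x` whose line does not contain its value. -/
theorem HeckeSeq.exists_lift {n : ℕ} {p : Fin n → CP1} (hp : Function.Injective p) (S : HeckeSeq p)
    {x : CP1} {t : ∀ y, (S.bundle 0).Fiber y} (ht : SecAt (S.bundle 0) t x) (i : Fin (n + 1)) :
    ∃ (t' : ∀ y, (S.bundle i).Fiber y) (h : CP1 → ℂ) (ε : ℕ), SecAt (S.bundle i) t' x ∧ HolAt h x ∧
      HasOrd h x ε ∧ (∀ᶠ y in 𝓝 x, S.comp i y (t' y) = h y • t y) ∧ ε ≤ 1 ∧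
      (ε ≠ 0 → ∃ j : Fin n, j.castSucc < i ∧ p j = x ∧ t (p j) ∉ S.line j) := by
  induction i using Fin.induction with
  | zero =>
    exact ⟨t, fun _ => 1, 0, ht, contMDiffAt_const, HolAt.hasOrd_zero contMDiffAt_const one_ne_zero,
      Eventually.of_forall fun y => (one_smul _ _).symm, zero_le_one, fun h => absurd rfl h⟩
  | succ i ih =>
    obtain ⟨t', h, ε, ht', hh, ho, hc, hε, hj⟩ := ih
    by_cases hx : x = p i → t' x ∈ LinearMap.range ((S.α i).onFiber x)
    · obtain ⟨t'', ht'', hα⟩ := (S.isHecke i).exists_lift ht' hx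
      refine ⟨t'', h, ε, ht'', hh, ho, ?_, hε, fun h0 => ?_⟩
      · filter_upwards [hc, hα] with y h1 h2
        rw [S.comp_succ, LinearMap.comp_apply, h2, h1]
      · obtain ⟨j, h1, h2⟩ := hj h0
        exact ⟨j, h1.trans Fin.castSucc_lt_succ, h2⟩
    · rw [Classical.not_imp] at hx
      obtain ⟨rfl, hx⟩ := hx
      -- the points are distinct, so no earlier modification took place at this point
      have hε0 : ε = 0 := by
        by_contra h0
        obtain ⟨j, h1, h2, -⟩ := hj h0
        rw [hp h2] at h1
        exact lt_irrefl _ h1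
      subst hε0
      have hl : HolAt (localCoord (p i)) (p i) :=
        holAt_chart_sub (chartAt_mem_maximalAtlas _) (mem_chart_source ℂ _) _
      have hl0 : localCoord (p i) (p i) = 0 := sub_self _
      obtain ⟨t'', ht'', hα⟩ := (S.isHecke i).exists_lift (ht'.smul hl) fun _ => by
        rw [hl0, zero_smul]
        exact Submodule.zero_mem _
      refine ⟨t'', fun y => localCoord (p i) y * h y, 1, ht'', hl.mul hh, ?_, ?_, le_rfl, fun _ => ?_⟩
      · simpa using (hasOrd_localCoord (p i)).mul ho
      · filter_upwards [hc, hα] with y h1 h2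
        rw [S.comp_succ, LinearMap.comp_apply, h2, map_smul, h1, smul_smul]
      · refine ⟨i, Fin.castSucc_lt_succ, rfl, ?_⟩
        rintro ⟨w, hw⟩
        apply hx
        -- `t' (p i)` would be `h (p i)` times a vector of the image
        have hinj : Function.Injective (S.comp i.castSucc (p i)) :=
          S.comp_injective (p i) i.castSucc fun j hj h => by
            rw [hp h] at hj
            exact lt_irrefl _ hj
        refine ⟨h (p i) • w, hinj ?_⟩
        rw [hc.self_of_nhds, ← hw, S.comp_succ, map_smul, LinearMap.comp_apply, map_smul]

/-! ### Frames of `O(m)` and of direct sums -/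

/-- The frame of `O(m)` over the domain of the `i`-th affine chart. -/
def lineFrame (m : ℤ) (i : Bool) (y : CP1) : (HolBundle.O m).Fiber y :=
  (lineBundleCore m).coordChange i ((lineBundleCore m).indexAt y) y (1 : ℂ)

theorem frameAt_lineFrame (m : ℤ) (i : Bool) {x : CP1} (hx : x ∈ (lineBundleCore m).baseSet i) :
    FrameAt (HolBundle.O m) (fun _ => lineFrame m i) x := by
  have key : ∀ y ∈ (lineBundleCore m).baseSet i,
      (lineBundleCore m).coordChange ((lineBundleCore m).indexAt y) i y (lineFrame m i y) =
        (1 : ℂ) := by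
    intro y hy
    rw [lineFrame, (lineBundleCore m).coordChange_comp i ((lineBundleCore m).indexAt y) i y
      ⟨⟨hy, (lineBundleCore m).mem_baseSet_at y⟩, hy⟩,
      (lineBundleCore m).coordChange_self i y hy]
  constructor
  · intro _
    have : MemTrivializationAtlas ((lineBundleCore m).localTriv i) := ⟨⟨i, rfl⟩⟩
    refine (((lineBundleCore m).localTriv i).contMDiffAt_section_iff (IB := 𝓘(ℂ)) (n := ω)
      (s := lineFrame m i) hx).2 ?_
    refine ContMDiffAt.congr_of_eventuallyEq (f := fun _ => (1 : ℂ)) contMDiffAt_const ?_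
    filter_upwards [((lineBundleCore m).isOpen_baseSet i).mem_nhds hx] with y hy
    exact key y hy
  · rw [linearIndependent_unique_iff]
    intro h0
    have h1 := key x hx
    rw [show lineFrame m i x = 0 from h0] at h1
    have h2 := ((lineBundleCore m).coordChange ((lineBundleCore m).indexAt x) i x).map_zero
    exact zero_ne_one (h2.symm.trans h1)

theorem lineFrame_false_eq (m : ℤ) {y : CP1} (h0 : y ≠ ((0 : ℂ) : CP1)) (h1 : y ≠ OnePoint.infty) :
    lineFrame m false y = wCoord y ^ m • lineFrame m true y := by
  have hz := zCoord_ne_zero h0 h1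
  have hi : (lineBundleCore m).indexAt y = false := by
    classical
    exact if_neg h1
  rw [lineFrame, lineFrame, hi]
  change (1 : ℂ) = wCoord y ^ m * (zCoord y ^ m * 1)
  rw [wCoord_eq_inv_zCoord, inv_zpow, mul_one, inv_mul_cancel₀ (zpow_ne_zero _ hz)]

open Classical in
/-- The divisor of the standard meromorphic section of `O(m)`. -/
def lineDivisor (m : ℤ) (x : CP1) : ℤ := if x = OnePoint.infty then m else 0

/-- The standard section of `O(m)` over the affine line is meromorphic at infinity, of order `m`. -/
theorem exists_frameAt_O (m : ℤ) (x : CP1) : ∃ (u : ∀ y, (HolBundle.O m).Fiber y) (g : CP1 → ℂ),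
    FrameAt (HolBundle.O m) (fun _ => u) x ∧ HasOrd g x (lineDivisor m x) ∧
      ∀ᶠ y in 𝓝[≠] x, lineFrame m false y = g y • u y := by
  by_cases hx : x = OnePoint.infty
  · subst hx
    refine ⟨lineFrame m true, fun y => wCoord y ^ m, frameAt_lineFrame m true ?_, ?_, ?_⟩
    · exact mem_chartW_source.2 (OnePoint.infty_ne_coe 0)
    · simpa [lineDivisor] using hasOrd_wCoord_infty.zpow m
    · filter_upwards [self_mem_nhdsWithin, eventually_ne_infty_coe 0] with y h1 h2
      exact lineFrame_false_eq m h2 h1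
  · exact ⟨lineFrame m false, fun _ => 1, frameAt_lineFrame m false hx, by
      simpa [lineDivisor, hx] using HolAt.hasOrd_zero contMDiffAt_const (one_ne_zero (α := ℂ)),
      Eventually.of_forall fun y => (one_smul _ _).symm⟩

theorem finite_support_lineDivisor (m : ℤ) : (Function.support (lineDivisor m)).Finite :=
  (Set.finite_singleton OnePoint.infty).subset fun x hx => by
    by_contra h
    exact hx (if_neg h)

theorem finsum_lineDivisor (m : ℤ) : ∑ᶠ x, lineDivisor m x = m := by
  exact (finsum_eq_single (lineDivisor m) OnePoint.infty fun x hx => if_neg hx).trans (if_pos rfl)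

theorem ιMulti_smul {k : ℕ} {V : Type*} [AddCommGroup V] [Module ℂ V] (c : Fin k → ℂ) (v : Fin k → V) :
    exteriorPower.ιMulti ℂ k (fun i => c i • v i) = (∏ i, c i) • exteriorPower.ιMulti ℂ k v :=
  (exteriorPower.ιMulti ℂ k).toMultilinearMap.map_smul_univ c v

theorem hasDegree_O (m : ℤ) : (HolBundle.O m).HasDegree m := by
  refine ⟨fun y => exteriorPower.ιMulti ℂ 1 fun _ => lineFrame m false y, lineDivisor m, fun x => ?_,
    finsum_lineDivisor m⟩
  obtain ⟨u, g, hu, hg, h1⟩ := exists_frameAt_O m x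
  refine hu.hasDetOrder_iff.2 ⟨g, hg, ?_⟩
  filter_upwards [h1] with y h2
  rw [h2, ιMulti_smul (fun _ => g y) fun _ => u y]
  simp

theorem secAt_directSum {E : HolBundle r} {E' : HolBundle s} {t : ∀ y, (E.directSum E').Fiber y}
    {x : CP1} : SecAt (E.directSum E') t x ↔
      SecAt E (fun y => (t y).1) x ∧ SecAt E' (fun y => (t y).2) x := by
  have h := contMDiffAt_section (IB := 𝓘(ℂ)) (n := ω) (F := (E.directSum E').Model)
    (E := (E.directSum E').Fiber) (s := t) x
  have h1 := contMDiffAt_section (IB := 𝓘(ℂ)) (n := ω) (F := E.Model)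
    (E := E.Fiber) (s := fun y => (t y).1) x
  have h2 := contMDiffAt_section (IB := 𝓘(ℂ)) (n := ω) (F := E'.Model)
    (E := E'.Fiber) (s := fun y => (t y).2) x
  rw [SecAt, SecAt, SecAt]
  refine h.trans (Iff.trans ?_ (and_congr h1 h2).symm)
  exact contMDiffAt_prod_module_iff _

/-- The projection to the first summand. -/
def HolHom.fst (E : HolBundle r) (E' : HolBundle s) : HolHom (E.directSum E') E :=
  HolHom.ofFrames (fun x => LinearMap.fst ℂ (E.Fiber x) (E'.Fiber x)) fun x => by
    obtain ⟨f, hf⟩ := exists_frameAt (E.directSum E') x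
    exact ⟨f, hf, fun j => (secAt_directSum.1 (hf.1 j)).1⟩

/-- The projection to the second summand. -/
def HolHom.snd (E : HolBundle r) (E' : HolBundle s) : HolHom (E.directSum E') E' :=
  HolHom.ofFrames (fun x => LinearMap.snd ℂ (E.Fiber x) (E'.Fiber x)) fun x => by
    obtain ⟨f, hf⟩ := exists_frameAt (E.directSum E') x
    exact ⟨f, hf, fun j => (secAt_directSum.1 (hf.1 j)).2⟩

/-- Two line bundle sections as a pair of sections of the direct sum. -/
def sumFrame {E E' : HolBundle 1} (u : ∀ y, E.Fiber y) (u' : ∀ y, E'.Fiber y) :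
    Fin 2 → ∀ y, (E.directSum E').Fiber y :=
  ![fun y => E.inlFiber E' y (u y), fun y => E.inrFiber E' y (u' y)]

theorem frameAt_sumFrame {E E' : HolBundle 1} {u : ∀ y, E.Fiber y} {u' : ∀ y, E'.Fiber y} {x : CP1}
    (h : FrameAt E (fun _ => u) x) (h' : FrameAt E' (fun _ => u') x) :
    FrameAt (E.directSum E') (sumFrame u u') x := by
  have h0 : SecAt E (fun y => 0) x := secAt_iff.2 fun i => by simpa using contMDiffAt_const
  have h0' : SecAt E' (fun y => 0) x := secAt_iff.2 fun i => by simpa using contMDiffAt_const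
  constructor
  · intro i
    fin_cases i
    · exact secAt_directSum.2 ⟨h.1 0, h0'⟩
    · exact secAt_directSum.2 ⟨h0, h'.1 0⟩
  · have hu : u x ≠ 0 := h.2.ne_zero 0
    have hu' : u' x ≠ 0 := h'.2.ne_zero 0
    rw [Fintype.linearIndependent_iff]
    intro c hc
    rw [Fin.sum_univ_two] at hc
    have h1 := congrArg ((HolHom.fst E E').onFiber x) hc
    have h2 := congrArg ((HolHom.snd E E').onFiber x) hc
    rw [map_add, map_smul, map_smul, map_zero] at h1 h2
    have h3 : c 0 • u x + c 1 • (0 : E.Fiber x) = 0 := h1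
    have h4 : c 0 • (0 : E'.Fiber x) + c 1 • u' x = 0 := h2
    rw [smul_zero, add_zero] at h3
    rw [smul_zero, zero_add] at h4
    intro i
    fin_cases i
    · exact (smul_eq_zero.1 h3).resolve_right hu
    · exact (smul_eq_zero.1 h4).resolve_right hu'

theorem hasDegree_directSum_O (a b : ℤ) :
    ((HolBundle.O a).directSum (HolBundle.O b)).HasDegree (a + b) := by
  refine ⟨fun y => exteriorPower.ιMulti ℂ 2
    fun i => sumFrame (lineFrame a false) (lineFrame b false) i y,
    fun x => lineDivisor a x + lineDivisor b x, fun x => ?_, ?_⟩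
  · obtain ⟨u, g, hu, hg, h1⟩ := exists_frameAt_O a x
    obtain ⟨u', g', hu', hg', h2⟩ := exists_frameAt_O b x
    refine (frameAt_sumFrame hu hu').hasDetOrder_iff.2 ⟨fun y => g y * g' y, hg.mul hg', ?_⟩
    filter_upwards [h1, h2] with y h3 h4
    have h5 : (fun i => sumFrame (lineFrame a false) (lineFrame b false) i y) =
        fun i => (![g y, g' y] : Fin 2 → ℂ) i • sumFrame u u' i y := by
      funext i
      fin_cases i
      · change (HolBundle.O a).inlFiber (HolBundle.O b) y (lineFrame a false y) =
          g y • (HolBundle.O a).inlFiber (HolBundle.O b) y (u y)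
        rw [h3, map_smul]
      · change (HolBundle.O a).inrFiber (HolBundle.O b) y (lineFrame b false y) =
          g' y • (HolBundle.O a).inrFiber (HolBundle.O b) y (u' y)
        rw [h4, map_smul]
    rw [h5, ιMulti_smul]
    simp
  · rw [finsum_add_distrib (finite_support_lineDivisor a) (finite_support_lineDivisor b),
      finsum_lineDivisor, finsum_lineDivisor]

/-! ### Degrees of line subbundles -/

/-- The fiberwise linear map `B : L → M` of line bundles is meromorphic at `x`, with a pole of order
at most `ε`: in suitable local frames `l`, `u` it is given by `b / h`, where `b` is holomorphic and `h` has
order at most `ε`. -/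
def PoleAtMost {L M : HolBundle 1} (B : ∀ y, L.Fiber y →ₗ[ℂ] M.Fiber y) (x : CP1) (ε : ℤ) : Prop :=
  ∃ (l : Fin 1 → ∀ y, L.Fiber y) (u : Fin 1 → ∀ y, M.Fiber y) (b h : CP1 → ℂ) (k : ℤ),
    FrameAt L l x ∧ FrameAt M u x ∧ HolAt b x ∧ HasOrd h x k ∧ k ≤ ε ∧
      ∀ᶠ y in 𝓝[≠] x, h y • B y (l 0 y) = b y • u 0 y

theorem FrameAt.exists_eq_smul {L : HolBundle 1} {l : Fin 1 → ∀ y, L.Fiber y} {x : CP1}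
    (h : FrameAt L l x) (v : L.Fiber x) : ∃ c : ℂ, v = c • l 0 x := by
  obtain ⟨c, rfl⟩ := h.exists_fiber_coeff v
  exact ⟨c 0, by simp⟩

theorem bijective_of_apply_ne_zero {L M : HolBundle 1} {x : CP1} (B : L.Fiber x →ₗ[ℂ] M.Fiber x)
    {l : Fin 1 → ∀ y, L.Fiber y} (hl : FrameAt L l x) (h : B (l 0 x) ≠ 0) : Function.Bijective B := by
  have hinj : Function.Injective B := by
    rw [injective_iff_map_eq_zero]
    intro v hv
    obtain ⟨c, rfl⟩ := hl.exists_eq_smul v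
    rw [map_smul, smul_eq_zero] at hv
    rw [hv.resolve_right h, zero_smul]
  exact ⟨hinj, (LinearMap.injective_iff_surjective_of_finrank_eq_finrank
    ((L.finrank_fiber x).trans (M.finrank_fiber x).symm)).1 hinj⟩

/-- A meromorphic map of line bundles that does not vanish identically near `x` has an order at `x`. -/
theorem PoleAtMost.exists_order {L M : HolBundle 1} {B : ∀ y, L.Fiber y →ₗ[ℂ] M.Fiber y} {x : CP1}
    {ε : ℤ} (h : PoleAtMost B x ε) (hB : ¬ ∀ᶠ y in 𝓝[≠] x, B y = 0) :
    ∃ (l : Fin 1 → ∀ y, L.Fiber y) (u : Fin 1 → ∀ y, M.Fiber y) (g : CP1 → ℂ) (k : ℤ),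
      FrameAt L l x ∧ FrameAt M u x ∧ HasOrd g x k ∧ -ε ≤ k ∧
        ∀ᶠ y in 𝓝[≠] x, Function.Bijective (B y) ∧ B y (l 0 y) = g y • u 0 y := by
  obtain ⟨l, u, b, h, e, hl, hu, hb, hh, he, hev⟩ := h
  have hb0 : ¬ ∀ᶠ y in 𝓝[≠] x, b y = 0 := by
    intro h0
    apply hB
    filter_upwards [h0, hev, hh.eventually, mem_nhdsWithin_of_mem_nhds hl.eventually]
      with y h1 h2 h3 h4
    rw [h1, zero_smul, smul_eq_zero] at h2
    ext v
    obtain ⟨c, rfl⟩ := h4.exists_eq_smul v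
    rw [map_smul, h2.resolve_left h3.2]
    simp
  obtain ⟨k, hk, hbk⟩ := hb.exists_hasOrd hb0
  refine ⟨l, u, fun y => b y / h y, k - e, hl, hu, hbk.div hh, by omega, ?_⟩
  filter_upwards [hev, hh.eventually, hbk.eventually, mem_nhdsWithin_of_mem_nhds hl.eventually,
    mem_nhdsWithin_of_mem_nhds hu.eventually] with y h1 h2 h3 h4 h5
  have h6 : B y (l 0 y) = (b y / h y) • u 0 y := by
    rw [div_eq_inv_mul, mul_smul, ← h1, smul_smul, inv_mul_cancel₀ h2.2, one_smul]
  refine ⟨bijective_of_apply_ne_zero _ h4 ?_, h6⟩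
  rw [h6]
  exact smul_ne_zero (div_ne_zero h3.2 h2.2) (h5.2.ne_zero 0)

/-- The identity theorem: a meromorphic map of line bundles that vanishes near one point vanishes near
every point. -/
theorem eventually_zero_or_forall_not {L M : HolBundle 1} {B : ∀ y, L.Fiber y →ₗ[ℂ] M.Fiber y} {ε : CP1 → ℤ}
    (h : ∀ x, PoleAtMost B x (ε x)) :
    (∀ x, ∀ᶠ y in 𝓝[≠] x, B y = 0) ∨ ∀ x, ¬ ∀ᶠ y in 𝓝[≠] x, B y = 0 := by
  set Z : Set CP1 := {x | ∀ᶠ y in 𝓝[≠] x, B y = 0} with hZ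
  have hopen : IsOpen Z := by
    rw [isOpen_iff_eventually]
    intro x hx
    have h1 : ∀ᶠ y in 𝓝[≠] x, y ∈ Z := by
      filter_upwards [eventually_eventually_nhdsWithin.2 hx, self_mem_nhdsWithin] with y h2 h3
      rw [IsOpen.nhdsWithin_eq isOpen_compl_singleton h3] at h2
      exact h2.filter_mono nhdsWithin_le_nhds
    rw [eventually_nhdsWithin_iff] at h1
    filter_upwards [h1] with y h2
    by_cases hy : y = x
    · rwa [hy]
    · exact h2 hy
  have hclosed : IsClosed Z := by
    rw [← isOpen_compl_iff, isOpen_iff_eventually]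
    intro x hx
    obtain ⟨l, u, g, k, hl, hu, hg, -, hev⟩ := (h x).exists_order hx
    have h0 : ∀ᶠ y in 𝓝[≠] x, B y ≠ 0 := by
      filter_upwards [hev, mem_nhdsWithin_of_mem_nhds hl.eventually] with y h1 h2 h3
      apply h2.2.ne_zero 0
      apply h1.1.1
      rw [h3]
      simp
    have h1 : ∀ᶠ y in 𝓝[≠] x, y ∈ Zᶜ := by
      filter_upwards [eventually_eventually_nhdsWithin.2 h0, self_mem_nhdsWithin] with y h2 h3 h4
      rw [IsOpen.nhdsWithin_eq isOpen_compl_singleton h3] at h2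
      obtain ⟨w, h5, h6⟩ := ((h2.filter_mono nhdsWithin_le_nhds).and h4).exists
      exact h5 h6
    rw [eventually_nhdsWithin_iff] at h1
    filter_upwards [h1] with y h2
    by_cases hy : y = x
    · rwa [hy]
    · exact h2 hy
  rcases isClopen_iff.1 ⟨hclosed, hopen⟩ with h0 | h0
  · exact Or.inr fun x hx => by
      have : x ∈ Z := hx
      rw [h0] at this
      exact this
  · exact Or.inl fun x => by
      have : x ∈ Z := h0 ▸ Set.mem_univ x
      exact this

/-- A nonzero meromorphic map `L → M` of line bundles with a polar divisor at most `ε` shows that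
`deg L ≤ deg M + deg ε`. -/
theorem HolBundle.HasDegree.exists_le {L M : HolBundle 1} {B : ∀ y, L.Fiber y →ₗ[ℂ] M.Fiber y}
    {ε : CP1 → ℤ} (hε : (Function.support ε).Finite) (h : ∀ x, PoleAtMost B x (ε x))
    (hB : ∀ x, ¬ ∀ᶠ y in 𝓝[≠] x, B y = 0) {d : ℤ} (hd : M.HasDegree d) :
    ∃ d', L.HasDegree d' ∧ d' ≤ d + ∑ᶠ x, ε x := by
  choose l u g κ hl hu hg hκ hev using fun x => (h x).exists_order (hB x)
  have h1 := hd.pullback B κ fun x => by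
    refine ⟨l x, u x, g x, hl x, hu x, hg x, ?_⟩
    filter_upwards [hev x] with y h1
    refine ⟨h1.1, ?_⟩
    have h2 : (fun i => B y (l x i y)) = fun i => (fun _ : Fin 1 => g x y) i • u x i y := by
      funext i
      fin_cases i
      exact h1.2
    rw [h2, ιMulti_smul]
    simp
  refine ⟨_, h1.2, ?_⟩
  have h2 : 0 ≤ ∑ᶠ x, (κ x + ε x) := finsum_nonneg fun x => by linarith [hκ x]
  rw [finsum_add_distrib h1.1 hε] at h2
  linarith

theorem HeckeSeq.hasDegree {n : ℕ} {p : Fin n → CP1} (S : HeckeSeq p) {d : ℤ}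
    (h : (S.bundle 0).HasDegree d) (i : Fin (n + 1)) : (S.bundle i).HasDegree (d - (i : ℕ)) := by
  induction i using Fin.induction with
  | zero => simpa using h
  | succ i ih =>
    have := (S.isHecke i).hasDegree ih
    simpa [sub_sub] using this

theorem HeckeSeq.eventually_bijective {n : ℕ} {p : Fin n → CP1} (S : HeckeSeq p) (i : Fin (n + 1))
    (x : CP1) : ∀ᶠ y in 𝓝[≠] x, Function.Bijective (S.comp i y) := by
  have h1 : ∀ᶠ y in 𝓝[≠] x, ∀ j, y ≠ p j := by
    refine eventually_all.2 fun j => ?_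
    by_cases hx : x = p j
    · rw [← hx]
      exact self_mem_nhdsWithin
    · exact mem_nhdsWithin_of_mem_nhds (isOpen_ne.mem_nhds hx)
  filter_upwards [h1] with y hy
  have hinj := S.comp_injective y i fun j _ => hy j
  exact ⟨hinj, (LinearMap.injective_iff_surjective_of_finrank_eq_finrank
    (((S.bundle i).finrank_fiber y).trans ((S.bundle 0).finrank_fiber y).symm)).1 hinj⟩

open Classical in
/-- The polar divisor of the map from a line subbundle `L` of `E₀` to `E_n`: the sum of the points `p i`
for which the line of the sequence is not the fiber of `L`. -/
def missDivisor {n : ℕ} {p : Fin n → CP1} (S : HeckeSeq p) (L : LineSub (S.bundle 0)) (x : CP1) : ℤ :=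
  ∑ i, if LinearMap.range (L.incl.onFiber (p i)) ≠ S.line i ∧ x = p i then 1 else 0

open Classical in
theorem finsum_missDivisor {n : ℕ} {p : Fin n → CP1} (S : HeckeSeq p) (L : LineSub (S.bundle 0)) :
    (Function.support (missDivisor S L)).Finite ∧ ∑ᶠ x, missDivisor S L x =
      ∑ i, if LinearMap.range (L.incl.onFiber (p i)) ≠ S.line i then (1 : ℤ) else 0 := by
  constructor
  · refine (Set.finite_range p).subset fun x hx => ?_
    obtain ⟨i, -, hi⟩ := Finset.exists_ne_zero_of_sum_ne_zero hx
    by_contra h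
    refine hi (if_neg fun h' => h ⟨i, h'.2.symm⟩)
  · unfold missDivisor
    rw [finsum_sum_comm]
    · refine Finset.sum_congr rfl fun i _ => ?_
      by_cases h : LinearMap.range (L.incl.onFiber (p i)) ≠ S.line i
      · simp only [h, true_and, ne_eq, not_false_eq_true, if_true]
        exact finsum_ite_eq (p i)
      · simp [h]
    · intro i _
      refine (Set.finite_singleton (p i)).subset fun x hx => ?_
      by_contra h
      exact hx (if_neg fun h' => h h'.2)

open Classical in
/-- The map that `L ⊆ E₀` and a map `pr` from `E_n` to a line bundle induce on the fibers over `y`, where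
the fibers of `E_n` and `E₀` can be identified (and `0` at the other points). -/
def inducedMap {n : ℕ} {p : Fin n → CP1} (S : HeckeSeq p) (L : LineSub (S.bundle 0)) {M : HolBundle 1}
    (pr : HolHom (S.bundle (Fin.last n)) M) (y : CP1) : L.L.Fiber y →ₗ[ℂ] M.Fiber y :=
  if h : Function.Bijective (S.comp (Fin.last n) y) then
    pr.onFiber y ∘ₗ (LinearEquiv.ofBijective (S.comp (Fin.last n) y) h).symm.toLinearMap ∘ₗ
      L.incl.onFiber y
  else 0

theorem inducedMap_apply {n : ℕ} {p : Fin n → CP1} {S : HeckeSeq p} {L : LineSub (S.bundle 0)}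
    {M : HolBundle 1} {pr : HolHom (S.bundle (Fin.last n)) M} {y : CP1}
    (h : Function.Bijective (S.comp (Fin.last n) y)) {v : L.L.Fiber y}
    {w : (S.bundle (Fin.last n)).Fiber y} (hw : S.comp (Fin.last n) y w = L.incl.onFiber y v) :
    inducedMap S L pr y v = pr.onFiber y w := by
  have h1 : (LinearEquiv.ofBijective (S.comp (Fin.last n) y) h).symm (L.incl.onFiber y v) = w := by
    rw [LinearEquiv.symm_apply_eq, ← hw]
    rfl
  rw [inducedMap, dif_pos h, LinearMap.comp_apply, LinearMap.comp_apply, LinearEquiv.coe_coe, h1]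

theorem poleAtMost_inducedMap {n : ℕ} {p : Fin n → CP1} (hp : Function.Injective p) (S : HeckeSeq p)
    (L : LineSub (S.bundle 0)) {M : HolBundle 1} (pr : HolHom (S.bundle (Fin.last n)) M) (x : CP1) :
    PoleAtMost (inducedMap S L pr) x (missDivisor S L x) := by
  classical
  obtain ⟨l, hl⟩ := exists_frameAt L.L x
  obtain ⟨u, hu⟩ := exists_frameAt M x
  obtain ⟨t, h, ε, ht, hh, ho, hc, hε, hj⟩ := S.exists_lift hp (L.incl.secAt (hl.1 0)) (Fin.last n)
  obtain ⟨b, hb, hbe⟩ := hu.exists_coeff (pr.secAt ht)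
  refine ⟨l, u, b 0, h, ε, hl, hu, hb 0, ho, ?_, ?_⟩
  · have h0 : ∀ i ∈ Finset.univ, (0 : ℤ) ≤
        if LinearMap.range (L.incl.onFiber (p i)) ≠ S.line i ∧ x = p i then 1 else 0 := by
      intro i _
      split_ifs <;> simp
    by_cases hε0 : ε = 0
    · rw [hε0]
      exact Finset.sum_nonneg h0
    · obtain ⟨j, -, hjx, hjl⟩ := hj hε0
      have h1 := Finset.single_le_sum h0 (Finset.mem_univ j)
      rw [if_pos ⟨fun h2 => hjl (h2 ▸ LinearMap.mem_range_self _ _), hjx.symm⟩] at h1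
      exact (by exact_mod_cast hε : (ε : ℤ) ≤ 1).trans h1
  · filter_upwards [mem_nhdsWithin_of_mem_nhds hc, mem_nhdsWithin_of_mem_nhds hbe,
      S.eventually_bijective (Fin.last n) x] with y h1 h2 h3
    rw [← map_smul, inducedMap_apply h3 (w := t y) (by rw [h1, map_smul]), h2]
    simp

/-- If a sequence of `n` Hecke modifications ends in `O(m) ⊕ O(m)`, and `E₀` has degree `0`, then a
line subbundle `L` of `E₀` passes through at most `n / 2 - deg L` of the lines of the sequence. -/
theorem LineSub.exists_hasDegree_le {n : ℕ} {p : Fin n → CP1} (hp : Function.Injective p)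
    (S : HeckeSeq p) (hdeg : (S.bundle 0).HasDegree 0) {m : ℤ}
    (φ : HolIso (S.bundle (Fin.last n)) ((HolBundle.O m).directSum (HolBundle.O m)))
    (L : LineSub (S.bundle 0)) : ∃ d, L.L.HasDegree d ∧
      2 * (d + Nat.card {i // LinearMap.range (L.incl.onFiber (p i)) = S.line i}) ≤ n := by
  classical
  have hm : (0 : ℤ) - n = m + m :=
    (S.hasDegree hdeg (Fin.last n)).unique ((hasDegree_directSum_O m m).of_iso φ)
  let pr₁ := (HolHom.fst (HolBundle.O m) (HolBundle.O m)).comp φ.hom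
  let pr₂ := (HolHom.snd (HolBundle.O m) (HolBundle.O m)).comp φ.hom
  obtain ⟨pr, hpr⟩ : ∃ pr : HolHom (S.bundle (Fin.last n)) (HolBundle.O m),
      ∀ x, ¬ ∀ᶠ y in 𝓝[≠] x, inducedMap S L pr y = 0 := by
    rcases eventually_zero_or_forall_not (poleAtMost_inducedMap hp S L pr₁) with h1 | h1
    · rcases eventually_zero_or_forall_not (poleAtMost_inducedMap hp S L pr₂) with h2 | h2
      · -- the two components of the injective map `L → O(m) ⊕ O(m)` cannot both vanish
        exfalso
        obtain ⟨y, ⟨hy1, hy2⟩, hy3⟩ := (((h1 OnePoint.infty).and (h2 OnePoint.infty)).and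
          (S.eventually_bijective (Fin.last n) OnePoint.infty)).exists
        obtain ⟨l, hl⟩ := exists_frameAt L.L y
        obtain ⟨w, hw⟩ := hy3.2 (L.incl.onFiber y (l 0 y))
        have h3 := inducedMap_apply (pr := pr₁) hy3 hw
        have h4 := inducedMap_apply (pr := pr₂) hy3 hw
        rw [hy1] at h3
        rw [hy2] at h4
        have h5 : φ.hom.onFiber y w = 0 := Prod.ext h3.symm h4.symm
        have h6 : w = 0 := (φ.bijective y).1 (by rw [h5, map_zero])
        rw [h6, map_zero] at hw
        exact hl.2.ne_zero 0 (L.injective y (by rw [← hw, map_zero]))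
      · exact ⟨pr₂, h2⟩
    · exact ⟨pr₁, h1⟩
  obtain ⟨d, hd, hle⟩ := HolBundle.HasDegree.exists_le (finsum_missDivisor S L).1
    (poleAtMost_inducedMap hp S L pr) hpr (hasDegree_O m)
  refine ⟨d, hd, ?_⟩
  rw [(finsum_missDivisor S L).2, Finset.sum_boole] at hle
  rw [Nat.card_eq_fintype_card, Fintype.card_subtype]
  have hcard := Finset.card_filter_add_card_filter_not (s := (Finset.univ : Finset (Fin n)))
    (fun i => LinearMap.range (L.incl.onFiber (p i)) = S.line i)
  rw [Finset.card_univ, Fintype.card_fin] at hcard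
  simp only [ne_eq] at hle
  omega

/-! ### Constant lines in a trivial bundle -/

theorem secAt_trivial (r : ℕ) (c : Fin r → ℂ) (x : CP1) :
    SecAt (HolBundle.trivial r) (fun _ => c) x :=
  (contMDiffAt_section (IB := 𝓘(ℂ)) (n := ω) (F := (HolBundle.trivial r).Model)
    (E := (HolBundle.trivial r).Fiber) (s := fun _ => c) x).2 contMDiffAt_const

theorem frameAt_trivial_one (x : CP1) :
    FrameAt (HolBundle.trivial 1) (fun _ _ => (1 : Fin 1 → ℂ)) x :=
  ⟨fun _ => secAt_trivial 1 1 x, linearIndependent_unique_iff.2 (one_ne_zero (α := Fin 1 → ℂ))⟩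

theorem hasDegree_trivial_one : (HolBundle.trivial 1).HasDegree 0 :=
  ⟨fun _ => exteriorPower.ιMulti ℂ 1 fun _ => (1 : Fin 1 → ℂ), fun _ => 0, fun x =>
    (frameAt_trivial_one x).hasDetOrder_iff.2 ⟨fun _ => 1,
      HolAt.hasOrd_zero contMDiffAt_const one_ne_zero,
      Eventually.of_forall fun _ => (one_smul _ _).symm⟩, finsum_zero⟩

/-- The line subbundle of `E` spanned by a constant vector, in a bundle with a global trivialization. -/
def constLineSub {E : HolBundle 2} (ψ : HolIso E (HolBundle.trivial 2)) {c : Fin 2 → ℂ} (hc : c ≠ 0) :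
    LineSub E where
  L := HolBundle.trivial 1
  incl := ψ.inv.comp (HolHom.ofFrames (E := HolBundle.trivial 1) (E' := HolBundle.trivial 2)
    (fun _ => LinearMap.toSpanSingleton ℂ (Fin 2 → ℂ) c ∘ₗ LinearMap.proj 0) fun x =>
      ⟨_, frameAt_trivial_one x, fun _ => by
        simpa using! secAt_trivial 2 c x⟩)
  injective := by
    intro x
    refine (ψ.symm.bijective x).1.comp fun v w h => ?_
    have h1 : (v : Fin 1 → ℂ) 0 • c = (w : Fin 1 → ℂ) 0 • c := h
    have h2 := smul_left_injective ℂ hc h1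
    funext i
    rw [Subsingleton.elim i 0]
    exact h2

theorem range_constLineSub {E : HolBundle 2} (ψ : HolIso E (HolBundle.trivial 2)) {c : Fin 2 → ℂ}
    (hc : c ≠ 0) {x : CP1} {ℓ : Submodule ℂ (E.Fiber x)}
    (h : ℓ.map (ψ.hom.onFiber x) = (Submodule.span ℂ {c} : Submodule ℂ (Fin 2 → ℂ))) :
    LinearMap.range ((constLineSub ψ hc).incl.onFiber x) = ℓ := by
  apply le_antisymm
  · rintro _ ⟨v, rfl⟩
    have h1 : (v : Fin 1 → ℂ) 0 • c ∈ (Submodule.span ℂ {c} : Submodule ℂ (Fin 2 → ℂ)) :=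
      Submodule.smul_mem _ _ (Submodule.mem_span_singleton_self c)
    rw [← h] at h1
    obtain ⟨w, hw, hwv⟩ := h1
    have h2 : (constLineSub ψ hc).incl.onFiber x v = w := by
      change ψ.inv.onFiber x ((v : Fin 1 → ℂ) 0 • c) = w
      rw [← hwv, ψ.inv_hom]
    rwa [h2]
  · intro w hw
    have h1 : ψ.hom.onFiber x w ∈ ℓ.map (ψ.hom.onFiber x) := Submodule.mem_map_of_mem hw
    rw [h] at h1
    obtain ⟨a, ha⟩ := Submodule.mem_span_singleton.1 h1
    refine ⟨fun _ => a, ?_⟩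
    change ψ.inv.onFiber x (a • c) = w
    rw [ha, ψ.inv_hom]

/-! ### Stability, and isomorphisms of parabolic bundles -/

section Parabolic

variable {ι : Type} {pt : ι → CP1}

theorem ParBundle.slope_eq_zero {P : ParBundle pt} (h : P.bundle.HasTrivialDet) : P.slope = 0 := by
  rw [ParBundle.slope, h.hasDegree.deg_eq]
  simp

theorem ParBundle.sign_eq (P : ParBundle pt) (L : LineSub P.bundle) (i : ι) :
    P.sign L i = 1 ∨ P.sign L i = -1 := by
  unfold ParBundle.sign
  split_ifs <;> simp

theorem ParBundle.abs_sum_sign_le [Fintype ι] (P : ParBundle pt) (L : LineSub P.bundle) :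
    |∑ i, P.sign L i| ≤ Fintype.card ι := by
  refine (Finset.abs_sum_le_sum_abs _ _).trans ?_
  have : ∀ i ∈ Finset.univ, |P.sign L i| ≤ 1 := fun i _ => by
    rcases P.sign_eq L i with h | h <;> simp [h]
  simpa using Finset.sum_le_sum this

theorem ParBundle.odd_sum_sign [Fintype ι] (hι : Odd (Fintype.card ι)) (P : ParBundle pt)
    (L : LineSub P.bundle) : Odd (∑ i, P.sign L i) := by
  have h1 : ∀ i ∈ Finset.univ, P.sign L i ≡ 1 [ZMOD 2] := fun i _ => by
    rcases P.sign_eq L i with h | h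
    · rw [h]
    · rw [h]; decide
  have h2 := Int.ModEq.sum h1
  rw [Finset.sum_const, Finset.card_univ, nsmul_one] at h2
  rw [Int.odd_iff]
  rw [← Int.odd_coe_nat, Int.odd_iff] at hι
  exact Eq.trans (show _ % 2 = _ % 2 from h2) hι

theorem ParBundle.subSlope_eq [Fintype ι] (μ : ℝ) (P : ParBundle pt) (L : LineSub P.bundle) :
    P.subSlope μ L = L.L.deg + μ * ((∑ i, P.sign L i : ℤ) : ℝ) := by
  rw [ParBundle.subSlope, Int.cast_sum]

/-- For an odd number of marked points and a small weight, there are no strictly semistable parabolic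
bundles: the sum of the signs of a line subbundle is odd, hence not zero. -/
theorem ParBundle.subSlope_ne_slope [Fintype ι] (hι : Odd (Fintype.card ι)) {μ : ℝ} (hμ : 0 < μ)
    (hμι : 2 * (Fintype.card ι : ℝ) * μ < 1) {P : ParBundle pt} (h : P.bundle.HasTrivialDet)
    (L : LineSub P.bundle) : P.subSlope μ L ≠ P.slope := by
  rw [P.subSlope_eq, ParBundle.slope_eq_zero h]
  intro h0
  have h1 := P.odd_sum_sign hι L
  have h2 := P.abs_sum_sign_le L
  set N := ∑ i, P.sign L i
  have h3 : |(N : ℝ)| ≤ Fintype.card ι := by exact_mod_cast h2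
  obtain ⟨h4, h5⟩ := abs_le.1 h3
  have h6 : (L.L.deg : ℝ) < 1 := by nlinarith
  have h7 : (-1 : ℝ) < L.L.deg := by nlinarith
  have h8 : L.L.deg = 0 := by
    have h6' : L.L.deg < 1 := by exact_mod_cast h6
    have h7' : -1 < L.L.deg := by exact_mod_cast h7
    omega
  rw [h8, Int.cast_zero, zero_add, mul_eq_zero] at h0
  rcases h0 with h0 | h0
  · exact hμ.ne' h0
  · have h9 : N = 0 := by exact_mod_cast h0
    rw [h9] at h1
    exact absurd h1 (by decide)

/-- The identity of a parabolic bundle. -/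
def ParIso.refl (P : ParBundle pt) : ParIso P P :=
  ⟨HolIso.refl _, fun _ => Submodule.map_id _⟩

/-- The inverse of an isomorphism of parabolic bundles. -/
def ParIso.symm {P P' : ParBundle pt} (φ : ParIso P P') : ParIso P' P :=
  ⟨φ.toHolIso.symm, fun i => by
    rw [← φ.map_line i]
    change ((P.line i).map (φ.hom.onFiber (pt i))).map (φ.inv.onFiber (pt i)) = P.line i
    rw [← Submodule.map_comp]
    have : φ.inv.onFiber (pt i) ∘ₗ φ.hom.onFiber (pt i) = LinearMap.id :=
      LinearMap.ext fun v => φ.inv_hom _ v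
    rw [this, Submodule.map_id]⟩

/-- The composition of isomorphisms of parabolic bundles. -/
def ParIso.trans {P P' P'' : ParBundle pt} (φ : ParIso P P') (ψ : ParIso P' P'') : ParIso P P'' :=
  ⟨φ.toHolIso.trans ψ.toHolIso, fun i => by
    rw [← ψ.map_line i, ← φ.map_line i, ← Submodule.map_comp]
    rfl⟩

theorem ParBundle.SEquiv.nonempty_parIso [Fintype ι] {μ : ℝ} {P P' : ParBundle pt}
    (hP : ∀ L : LineSub P.bundle, P.subSlope μ L ≠ P.slope)
    (hP' : ∀ L : LineSub P'.bundle, P'.subSlope μ L ≠ P'.slope) (h : P.SEquiv μ P') :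
    Nonempty (ParIso P P') := by
  obtain ⟨G, h1 | ⟨L, _, _, _, _, hL, _⟩, h2 | ⟨L', _, _, _, _, hL', _⟩⟩ := h
  · obtain ⟨⟨-, ⟨φ⟩⟩, ⟨-, ⟨φ'⟩⟩⟩ := And.intro h1 h2
    exact ⟨φ.trans φ'.symm⟩
  · exact absurd hL' (hP' L')
  · exact absurd hL (hP L)
  · exact absurd hL (hP L)

/-- For an odd number of marked points and a small weight, the points of `M^ss` are isomorphism
classes of parabolic bundles. -/
theorem Mss.nonempty_parIso [Fintype ι] (hι : Odd (Fintype.card ι)) {μ : ℝ} (hμ : 0 < μ)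
    (hμι : 2 * (Fintype.card ι : ℝ) * μ < 1) {P P' : SemistablePar μ pt}
    (h : (Quot.mk _ P : Mss μ pt) = Quot.mk _ P') : Nonempty (ParIso P.toParBundle P'.toParBundle) := by
  have h1 := Quot.eqvGen_exact h
  clear h
  induction h1 with
  | rel P P' h =>
    exact h.nonempty_parIso (ParBundle.subSlope_ne_slope hι hμ hμι P.trivialDet)
      (ParBundle.subSlope_ne_slope hι hμ hμι P'.trivialDet)
  | refl P => exact ⟨ParIso.refl _⟩
  | symm P P' _ ih =>
    obtain ⟨φ⟩ := ih
    exact ⟨φ.symm⟩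
  | trans P P' P'' _ _ ih ih' =>
    obtain ⟨φ⟩ := ih
    obtain ⟨ψ⟩ := ih'
    exact ⟨φ.trans ψ⟩

theorem Mss.mk_eq_of_parIso [Fintype ι] (hι : Odd (Fintype.card ι)) {μ : ℝ} (hμ : 0 < μ)
    (hμι : 2 * (Fintype.card ι : ℝ) * μ < 1) {P P' : ParBundle pt} (hdet : P.bundle.HasTrivialDet)
    (hss : P.IsSemistable μ) (hdet' : P'.bundle.HasTrivialDet) (hss' : P'.IsSemistable μ)
    (φ : ParIso P P') : Mss.mk P hdet hss = Mss.mk P' hdet' hss' := by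
  refine Quot.sound ⟨P', Or.inl ⟨fun L => ?_, ⟨φ⟩⟩, Or.inl ⟨fun L => ?_, ⟨ParIso.refl P'⟩⟩⟩
  · exact (hss L).lt_of_ne (ParBundle.subSlope_ne_slope hι hμ hμι hdet L)
  · exact (hss' L).lt_of_ne (ParBundle.subSlope_ne_slope hι hμ hμι hdet' L)

end Parabolic

/-! ### The map from sequences to parabolic bundles -/

section Sequences

variable {n : ℕ} {μ : ℝ} {q : Fin 3 → CP1} {p : Fin n → CP1}

theorem HpSeq.exists_terminal_iso (hn : Even n) (S : HpSeq μ q p) : ∃ m : ℤ,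
    Nonempty (HolIso (S.bundle (Fin.last n)) ((HolBundle.O m).directSum (HolBundle.O m))) := by
  obtain ⟨a, b, hφ, hab⟩ := S.heckeLength
  rw [Nat.even_iff.1 hn] at hab
  obtain rfl : a = b := by omega
  exact ⟨a, hφ⟩

theorem HpSeq.deg_add_card_le (hn : Even n) (hp : Function.Injective p) (S : HpSeq μ q p)
    (L : LineSub (S.bundle 0)) :
    2 * (L.L.deg + Nat.card {i // LinearMap.range (L.incl.onFiber (p i)) = S.line i}) ≤ n := by
  obtain ⟨m, ⟨φ⟩⟩ := S.exists_terminal_iso hn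
  obtain ⟨d, hd, h⟩ := L.exists_hasDegree_le hp S.toHeckeSeq S.trivialDet.hasDegree φ
  rwa [hd.deg_eq]

/-- A line subbundle `L` of degree `0` contains at most `n / 2` of the lines at the points `p i`, and at
most one of those at the points `q j`, by the stability of the initial parabolic bundle. -/
theorem HpSeq.isSemistable (hn : Even n) (hμ : 0 < μ) (hμn : 2 * ((n : ℝ) + 3) * μ < 1)
    (hpq : Function.Injective (Sum.elim p q)) (S : HpSeq μ q p) :
    (S.toPar hpq).IsSemistable μ := by
  classical
  have hp : Function.Injective p := fun a b h => Sum.inl_injective (hpq h)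
  intro (L : LineSub (S.bundle 0))
  have hkey := S.deg_add_card_le hn hp L
  have hst : S.init.subSlope μ L < S.init.slope := S.stable L
  have hslope : S.init.slope = 0 := ParBundle.slope_eq_zero S.trivialDet
  have hslope' : (S.toPar hpq).slope = 0 := ParBundle.slope_eq_zero S.trivialDet
  have hsub : S.init.subSlope μ L = L.L.deg + μ * ((∑ j, S.init.sign L j : ℤ) : ℝ) :=
    ParBundle.subSlope_eq μ S.init L
  have hsub' : (S.toPar hpq).subSlope μ L =
      L.L.deg + μ * ((∑ i, (S.toPar hpq).sign L i : ℤ) : ℝ) :=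
    ParBundle.subSlope_eq μ (S.toPar hpq) L
  rw [hslope, hsub] at hst
  rw [hslope', hsub', Fintype.sum_sum_type]
  have hq : |∑ j, S.init.sign L j| ≤ Fintype.card (Fin 3) := S.init.abs_sum_sign_le L
  have hq' : ∑ j, (S.toPar hpq).sign L (Sum.inr j) = ∑ j, S.init.sign L j := rfl
  rw [hq']
  -- the signs at the points `p i` sum to `2 k - n`, where `k` is the number of lines in `L`
  have hsum : ∑ i, (S.toPar hpq).sign L (Sum.inl i) =
      2 * Nat.card {i // LinearMap.range (L.incl.onFiber (p i)) = S.line i} - n := by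
    have h1 : ∀ i, (S.toPar hpq).sign L (Sum.inl i) =
        2 * (if LinearMap.range (L.incl.onFiber (p i)) = S.line i then 1 else 0) - 1 := by
      intro i
      change (if LinearMap.range (L.incl.onFiber (p i)) = S.line i then (1 : ℤ) else -1) = _
      split_ifs <;> simp
    rw [Finset.sum_congr rfl fun i _ => h1 i, Finset.sum_sub_distrib, ← Finset.mul_sum,
      Finset.sum_boole, Nat.card_eq_fintype_card, Fintype.card_subtype]
    simp
  rw [hsum]
  have hk : Nat.card {i // LinearMap.range (L.incl.onFiber (p i)) = S.line i} ≤ n := by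
    simpa using Finite.card_subtype_le (α := Fin n)
      fun i => LinearMap.range (L.incl.onFiber (p i)) = S.line i
  set k := Nat.card {i // LinearMap.range (L.incl.onFiber (p i)) = S.line i}
  set B := ∑ j, S.init.sign L j
  set d := L.L.deg
  rw [Fintype.card_fin] at hq
  obtain ⟨hq1, hq2⟩ := abs_le.1 hq
  have hq1' : (-3 : ℝ) ≤ B := by exact_mod_cast hq1
  have hq2' : (B : ℝ) ≤ 3 := by exact_mod_cast hq2
  have hn0 : (0 : ℝ) ≤ n := Nat.cast_nonneg n
  have hk' : (k : ℝ) ≤ n := by exact_mod_cast hk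
  push_cast
  -- the weight is so small that only the sign of `d` matters, unless `d = 0`
  rcases lt_trichotomy d 0 with hd | hd | hd
  · have hd' : (d : ℝ) ≤ -1 := by exact_mod_cast (by omega : d ≤ -1)
    nlinarith
  · rw [hd, zero_add] at hkey
    have hk2 : (2 * k : ℝ) ≤ n := by exact_mod_cast hkey
    rw [hd, Int.cast_zero, zero_add] at hst ⊢
    nlinarith
  · have hd' : (1 : ℝ) ≤ d := by exact_mod_cast hd
    nlinarith

theorem HpSeq.card_line_eq_le (hn : Even n) (hp : Function.Injective p) (S : HpSeq μ q p)
    (ψ : HolIso (S.bundle 0) (HolBundle.trivial 2)) (Λ : Submodule ℂ (Fin 2 → ℂ))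
    (hΛ : finrank ℂ Λ = 1) :
    2 * Nat.card {i : Fin n // (S.line i).map (ψ.hom.onFiber (p i)) = Λ} ≤ n := by
  obtain ⟨c, hc, rfl⟩ : ∃ c : Fin 2 → ℂ, c ≠ 0 ∧ Λ = Submodule.span ℂ {c} := by
    obtain ⟨v, hv, hspan⟩ := finrank_eq_one_iff'.1 hΛ
    refine ⟨v, fun h => hv (Subtype.ext h), le_antisymm (fun w hw => ?_) ?_⟩
    · obtain ⟨a, ha⟩ := hspan ⟨w, hw⟩
      exact Submodule.mem_span_singleton.2 ⟨a, congrArg Subtype.val ha⟩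
    · rw [Submodule.span_singleton_le_iff_mem]
      exact v.2
  have h1 := S.deg_add_card_le hn hp (constLineSub ψ hc)
  have h2 : (constLineSub ψ hc).L.deg = 0 := hasDegree_trivial_one.deg_eq
  rw [h2, zero_add] at h1
  have h3 := Nat.card_le_card_of_injective
    (Subtype.map (p := fun i : Fin n => (S.line i).map (ψ.hom.onFiber (p i)) = Submodule.span ℂ {c})
      (q := fun i => LinearMap.range ((constLineSub ψ hc).incl.onFiber (p i)) = S.line i) id
      fun i hi => range_constLineSub ψ hc hi) (Subtype.map_injective _ Function.injective_id)
  omega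

/-- Isomorphic sequences have isomorphic parabolic bundles. -/
theorem ParHeckeSeq.Isomorphic.nonempty_parIso (hpq : Function.Injective (Sum.elim p q))
    {S S' : ParHeckeSeq q p} (h : S.Isomorphic S') :
    Nonempty (ParIso (S.toPar hpq) (S'.toPar hpq)) := by
  obtain ⟨φ, hφ, hline⟩ := h
  have hcomp : ∀ (i : Fin (n + 1)) (x : CP1) (v : (S.bundle i).Fiber x),
      S'.comp i x ((φ i).hom.onFiber x v) = (φ 0).hom.onFiber x (S.comp i x v) := by
    intro i
    induction i using Fin.induction with
    | zero => exact fun _ _ => rfl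
    | succ i ih =>
      intro x v
      rw [S'.comp_succ, LinearMap.comp_apply, hφ, ih]
      rfl
  refine ⟨⟨φ 0, ?_⟩⟩
  rintro (i | j)
  · change (S.line i).map ((φ 0).hom.onFiber (p i)) = S'.line i
    rw [HeckeSeq.line, HeckeSeq.line, ← LinearMap.range_comp]
    have h1 : (φ 0).hom.onFiber (p i) ∘ₗ S.comp i.succ (p i) =
        S'.comp i.succ (p i) ∘ₗ (φ i.succ).hom.onFiber (p i) :=
      LinearMap.ext fun v => (hcomp i.succ (p i) v).symm
    rw [h1, LinearMap.range_comp_of_range_eq_top _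
      (LinearMap.range_eq_top.2 ((φ i.succ).bijective (p i)).2)]
  · exact hline j

/-- Sequences with isomorphic parabolic bundles are isomorphic. -/
theorem ParHeckeSeq.isomorphic_of_parIso (hpq : Function.Injective (Sum.elim p q))
    {S S' : ParHeckeSeq q p} (φ : ParIso (S.toPar hpq) (S'.toPar hpq)) : S.Isomorphic S' := by
  obtain ⟨Φ, hΦ, hα⟩ := S.toHeckeSeq.exists_iso (fun a b h => Sum.inl_injective (hpq h))
    S'.toHeckeSeq φ.toHolIso fun i => φ.map_line (Sum.inl i)
  refine ⟨Φ, hα, fun j => ?_⟩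
  rw [hΦ]
  exact φ.map_line (Sum.inr j)

end Sequences

end

end HeckeEmbedding

open HeckeEmbedding
theorem theorem2 {n : ℕ} (hn : Even n) (μ : ℝ) (hμ : 0 < μ) (hμn : 2 * ((n : ℝ) + 3) * μ < 1)
    (q : Fin 3 → CP1) (p : Fin n → CP1) (hpq : Function.Injective (Sum.elim p q)) :
    (∃ hss : ∀ S : HpSeq μ q p, (S.toPar hpq).IsSemistable μ,
      ∃ Φ : Hp μ q p → Mss μ (Sum.elim p q),
        (∀ S : HpSeq μ q p, Φ (Hp.mk S) = Mss.mk (S.toPar hpq) S.trivialDet (hss S)) ∧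
        Function.Injective Φ) ∧
    ∀ (S : HpSeq μ q p) (ψ : HolIso (S.bundle 0) (HolBundle.trivial 2))
      (Λ : Submodule ℂ (Fin 2 → ℂ)), Module.finrank ℂ Λ = 1 →
        2 * Nat.card {i : Fin n // (S.line i).map (ψ.hom.onFiber (p i)) = Λ} ≤ n := by
  have hp : Function.Injective p := fun a b h => Sum.inl_injective (hpq h)
  have hι : Odd (Fintype.card (Fin n ⊕ Fin 3)) := by
    simpa using hn.add_odd (by decide : Odd 3)
  have hμι : 2 * (Fintype.card (Fin n ⊕ Fin 3) : ℝ) * μ < 1 := by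
    simpa using hμn
  have hss := fun S : HpSeq μ q p => S.isSemistable hn hμ hμn hpq
  refine ⟨⟨hss, Quot.lift (fun S => Mss.mk (S.toPar hpq) S.trivialDet (hss S)) fun S S' h => ?_,
    fun S => rfl, ?_⟩, fun S ψ Λ hΛ => S.card_line_eq_le hn hp ψ Λ hΛ⟩
  · obtain ⟨φ⟩ := h.nonempty_parIso hpq
    exact Mss.mk_eq_of_parIso hι hμ hμι _ _ _ _ φ
  · rintro ⟨S⟩ ⟨S'⟩ h
    obtain ⟨φ⟩ := Mss.nonempty_parIso hι hμ hμι h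
    exact Quot.sound (ParHeckeSeq.isomorphic_of_parIso hpq φ)
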